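/- **Proposition (equivalence of processor sharing and random order of service with balking).** Consider two single-server queues with Poisson arrivals of rate $\lambda>0$ and i.i.d. exponential service requirements with parameter $\mu>0$, and let $\rho=\lambda/\mu$. In the first queue (PS) all customers present share the server equally, and a customer that finds $n$ customers in the system joins with probability $b_n\in[0,1]$ and otherwise balks. In the second queue (ROS) customers are served one at a time, at each service completion the next customer is chosen uniformly at random among those waiting, and a customer that finds $n$ customers in the system (including the one in service) joins with probability $b_n^r$. Let $\mathcal V_n$ be the sojourn time of a customer that joins the PS queue and finds $n$ others there, and let $\mathcal W_n$ be the waiting time, until service begins, of a customer that joins the ROS queue and finds $n$ others waiting and one customer in service. Suppose that $b_0^r=1$ and $b_n^r=b_{n-1}$ for $n\ge 1$. Then: 1. $\mathcal V_n$ and $\mathcal W_n$ are equal in distribution for every $n\ge 0$. 2. Suppose moreover that $b_0>0$ and that both queues have a stationary distribution. Let $\mathcal V$ be the steady-state sojourn time of a non-balking customer in the PS queue, and $\mathcal W$ the steady-state waiting time of a non-balking customer in the ROS queue ($\mathcal W=0$ for a customer that finds the system empty). Then for all $t\ge 0$ $$\mathrm{Prob}[\mathcal V>t]=C\cdot \mathrm{Prob}[\mathcal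 W>t],\qquad C=\frac1\rho\cdot\frac{1+\sum_{n=1}^\infty\rho^n\,b_0b_1\cdots b_{n-1}}{b_0+\sum_{n=1}^\infty\rho^n\,b_0b_1\cdots b_n},$$ where both series converge. (If $b_0=1$, the denominator is $1+\sum_{n=1}^\infty\rho^n\,b_0\cdots b_n$.) 3. If $b_n=1/(n+1)$ for all $n\ge0$, then $C=e^\rho/(e^\rho-1)$. -/

import Mathlib

open MeasureTheory ProbabilityTheory
open scoped ENNReal

/-! ### Randomness -/

/-- The uniform distribution on `[0, 1]`. -/
noncomputable def uniform01 : Measure ℝ := volume.restrict (Set.Icc 0 1)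

/-- The fresh random numbers available at one event (an arrival or a service completion).
They are discarded if the event does not need them. -/
abbrev Draw := ℝ × ℝ × ℝ × ℝ

/-- Time from this arrival to the next one. -/
def Draw.gap (d : Draw) : ℝ := d.1

/-- A fresh service requirement. -/
def Draw.work (d : Draw) : ℝ := d.2.1

/-- An arriving customer that finds `k` customers joins if and only if `mark < b k`. -/
def Draw.mark (d : Draw) : ℝ := d.2.2.1

/-- Decides which waiting customer is selected for service (random order of service only). -/
def Draw.pick (d : Draw) : ℝ := d.2.2.2

/-- Arrivals are Poisson with rate `lam`, service requirements are exponential with rate `mu`. -/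
noncomputable def drawLaw (lam mu : ℝ) : Measure Draw :=
  (expMeasure lam).prod ((expMeasure mu).prod (uniform01.prod uniform01))

/-- Everything random that happens after the tagged customer has joined: the time until the next
arrival, the (residual) service requirements of the customers present at time `0`, and the draws
at the successive events. -/
abbrev Sample := ℝ × (ℕ → ℝ) × (ℕ → Draw)

noncomputable def sampleLaw (lam mu : ℝ) : Measure Sample :=
  (expMeasure lam).prod
    ((Measure.infinitePi fun _ : ℕ => expMeasure mu).prod
      (Measure.infinitePi fun _ : ℕ => drawLaw lam mu))

/-! ### The processor sharing queue, seen from a tagged customer -/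

/-- State of the processor sharing queue while the tagged customer is present, together with
`others` other customers. The customers are numbered `0, …, others`, number `0` is the tagged one,
and `residual i` is the service requirement that customer `i` still has; values of `residual`
beyond `others` are irrelevant. -/
structure PSState where
  clock : ℝ
  untilArrival : ℝ
  others : ℕ
  residual : ℕ → ℝ

/-- The customer that completes next if nobody arrives: the one with the least residual
requirement (the first of these in case of a tie). -/
noncomputable def PSState.next (s : PSState) : ℕ :=
  sInf {i | i ≤ s.others ∧ ∀ j ≤ s.others, s.residual i ≤ s.residual j}

open Classical in
/-- One event of the processor sharing queue. All `others + 1` customers are served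
simultaneously, each at rate `1 / (others + 1)`. The result `Sum.inr τ` means that the tagged
customer has left at time `τ`. -/
noncomputable def psStep (b : ℕ → ℝ) : PSState ⊕ ℝ → Draw → PSState ⊕ ℝ
  | Sum.inr τ, _ => Sum.inr τ
  | Sum.inl s, d =>
    let size : ℝ := s.others + 1
    let w : ℝ := s.residual s.next
    if size * w ≤ s.untilArrival then
      -- customer `s.next` completes, after everyone has received an amount `w` of service
      if s.next = 0 then Sum.inr (s.clock + size * w)
      else Sum.inl
        { clock := s.clock + size * w
          untilArrival := s.untilArrival - size * w
          others := s.others - 1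
          residual := fun j =>
            if j < s.next then s.residual j - w else s.residual (j + 1) - w }
    else
      -- an arrival, which finds `others + 1` customers in the system
      let rest : ℕ → ℝ := fun j => s.residual j - s.untilArrival / size
      if d.mark < b (s.others + 1) then Sum.inl
        { clock := s.clock + s.untilArrival
          untilArrival := d.gap
          others := s.others + 1
          residual := Function.update rest (s.others + 1) d.work }
      else Sum.inl
        { clock := s.clock + s.untilArrival
          untilArrival := d.gap
          others := s.others
          residual := rest }

/-- The processor sharing queue after `k` events, when the tagged customer has joined at time `0`
and has found `n` others. -/
noncomputable def psRun (b : ℕ → ℝ) (n : ℕ) (ω : Sample) : ℕ → PSState ⊕ ℝ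
  | 0 => Sum.inl
      { clock := 0
        untilArrival := ω.1
        others := n
        residual := ω.2.1 }
  | k + 1 => psStep b (psRun b n ω k) (ω.2.2 k)

/-- The sojourn time `V_n` of a customer that joins a processor sharing queue with `n` others
(`⊤` if it never leaves). -/
noncomputable def psSojourn (b : ℕ → ℝ) (n : ℕ) (ω : Sample) : ℝ≥0∞ :=
  ⨅ k : ℕ, Sum.elim (fun _ => ⊤) ENNReal.ofReal (psRun b n ω k)

/-! ### The random order of service queue, seen from a tagged customer -/

/-- State of the random-order-of-service queue while the tagged customer is waiting: one customer
is in service with residual requirement `inService`, and `others` customers are waiting besides the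
tagged one. -/
structure ROSState where
  clock : ℝ
  untilArrival : ℝ
  others : ℕ
  inService : ℝ

open Classical in
/-- One event of the random-order-of-service queue. On a service completion one of the
`others + 1` waiting customers, numbered `0, …, others` with number `0` the tagged one, is selected
uniformly at random and its service starts. The result `Sum.inr τ` means that the service of the
tagged customer has started at time `τ`. -/
noncomputable def rosStep (br : ℕ → ℝ) : ROSState ⊕ ℝ → Draw → ROSState ⊕ ℝ
  | Sum.inr τ, _ => Sum.inr τ
  | Sum.inl s, d =>
    if s.inService ≤ s.untilArrival then
      -- a service completion
      if ⌊d.pick * (s.others + 1)⌋₊ = 0 then Sum.inr (s.clock + s.inService)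
      else Sum.inl
        { clock := s.clock + s.inService
          untilArrival := s.untilArrival - s.inService
          others := s.others - 1
          inService := d.work }
    else
      -- an arrival, which finds `others + 2` customers in the system
      Sum.inl
        { clock := s.clock + s.untilArrival
          untilArrival := d.gap
          others := if d.mark < br (s.others + 2) then s.others + 1 else s.others
          inService := s.inService - s.untilArrival }

/-- The random-order-of-service queue after `k` events, when the tagged customer has joined at
time `0` and has found one customer in service and `n` others waiting. -/
noncomputable def rosRun (br : ℕ → ℝ) (n : ℕ) (ω : Sample) : ℕ → ROSState ⊕ ℝ
  | 0 => Sum.inl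
      { clock := 0
        untilArrival := ω.1
        others := n
        inService := ω.2.1 0 }
  | k + 1 => rosStep br (rosRun br n ω k) (ω.2.2 k)

/-- The waiting time `W_n` of a customer that joins a random-order-of-service queue with one
customer in service and `n` others waiting (`⊤` if its service never starts). -/
noncomputable def rosWait (br : ℕ → ℝ) (n : ℕ) (ω : Sample) : ℝ≥0∞ :=
  ⨅ k : ℕ, Sum.elim (fun _ => ⊤) ENNReal.ofReal (rosRun br n ω k)

/-! ### Steady state -/

/-- `π` is a stationary distribution of the number of customers in a single-server Markovian queue
with balking: the number `n` increases at rate `lam * b n` and, if `n ≥ 1`, decreases at rate `mu`.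
As arrivals are Poisson, this is also the distribution of the number found by an arriving customer
(balking or not) in steady state. -/
structure IsSteadyState (lam mu : ℝ) (b : ℕ → ℝ) (π : PMF ℕ) : Prop where
  balance_zero : lam * b 0 * (π 0).toReal = mu * (π 1).toReal
  balance_succ : ∀ n : ℕ, (lam * b (n + 1) + mu) * (π (n + 1)).toReal =
    lam * b n * (π n).toReal + mu * (π (n + 2)).toReal

/-- Joint law of the number found by a customer arriving in steady state, its balking mark, and
what happens after its arrival. -/
noncomputable def arrivalLaw (lam mu : ℝ) (π : PMF ℕ) : Measure (ℕ × ℝ × Sample) :=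
  π.toMeasure.prod (uniform01.prod (sampleLaw lam mu))

/-- The event that the arriving customer does not balk. -/
def joins (b : ℕ → ℝ) : Set (ℕ × ℝ × Sample) := {x | x.2.1 < b x.1}

/-- Steady-state waiting time under random order of service: it is `0` for a customer that finds
the system empty. -/
noncomputable def rosWaitFinding (br : ℕ → ℝ) : ℕ → Sample → ℝ≥0∞
  | 0, _ => 0
  | n + 1, ω => rosWait br n ω

/-- `Prob[V > t]`: the tail of the steady-state sojourn time of a non-balking customer in the
processor sharing queue. -/
noncomputable def psTail (lam mu : ℝ) (b : ℕ → ℝ) (π : PMF ℕ) (t : ℝ) : ℝ :=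
  (cond (arrivalLaw lam mu π) (joins b)).real {x | ENNReal.ofReal t < psSojourn b x.1 x.2.2}

/-- `Prob[W > t]`: the tail of the steady-state waiting time of a non-balking customer in the
random-order-of-service queue. -/
noncomputable def rosTail (lam mu : ℝ) (br : ℕ → ℝ) (π : PMF ℕ) (t : ℝ) : ℝ :=
  (cond (arrivalLaw lam mu π) (joins br)).real
    {x | ENNReal.ofReal t < rosWaitFinding br x.1 x.2.2}

/-- The constant
`C = (1 / ρ) (1 + ∑_{n ≥ 1} ρ ^ n b_0 ⋯ b_{n-1}) / (b_0 + ∑_{n ≥ 1} ρ ^ n b_0 ⋯ b_n)`. -/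
noncomputable def equivConst (ρ : ℝ) (b : ℕ → ℝ) : ℝ :=
  1 / ρ * ((1 + ∑' n : ℕ, ρ ^ (n + 1) * ∏ i ∈ Finset.range (n + 1), b i) /
    (b 0 + ∑' n : ℕ, ρ ^ (n + 1) * ∏ i ∈ Finset.range (n + 2), b i))

/-!
The two queues are equivalent because, as long as the tagged customer is present (processor sharing)
or waiting (random order of service), they run through the same Markov chain of events. With `n`
others, the next completion and the next arrival are competing exponential clocks of rates `mu` and
`lam` in both queues; a completion takes the tagged customer with probability `1 / (n + 1)`; and an
arrival joins with probability `b (n + 1) = br (n + 2)`. For random order of service this is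
immediate from memorylessness. For processor sharing, the least of `n + 1` independent exponential
requirements, served at speed `1 / (n + 1)`, is again exponential of rate `mu`, it belongs to each
customer with equal probability, and what the others still have is again i.i.d. exponential
(`setLIntegral_pi_sub_expMeasure`).

To make this precise, a function `F` of the state is averaged over the running clocks (`psValue`,
`rosValue`), and the transition operator `transOp` is applied to it. Both averages satisfy the same
recursion `eventValue` (`psValue_transOp`, `rosValue_transOp`), so the time at which the tagged
customer has left by the `k`-th event, `⊤` if it has not, has the same law in the two queues for
every `k`. The sojourn time and the waiting time are the infima over `k` of these antitone sequences
(`identDistrib_psSojourn_rosWait`).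

In steady state, detailed balance gives the number found by a joining customer of the processor
sharing queue the weights `ρ ^ n * b 0 * ⋯ * b n`. In the other queue a joining customer finds
`n + 1` customers with `ρ` times this weight, and it finds the system empty with weight `1`, in
which case it does not wait. The two tails are therefore proportional, and `equivConst` is the quotient of
the normalizing constants (`psTail_eq_equivConst_mul_rosTail`).
-/

/-! ### Product measures -/

/-- An i.i.d. sequence is an independent first term followed by an i.i.d. sequence. -/
lemma lintegral_infinitePi_succ {X : Type*} [MeasurableSpace X] (P : Measure X)
    [IsProbabilityMeasure P] {G : (ℕ → X) → ℝ≥0∞} (hG : Measurable G) :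
    ∫⁻ D, G D ∂(Measure.infinitePi fun _ : ℕ => P) =
      ∫⁻ d, ∫⁻ D, G (fun k => Nat.casesOn k d D) ∂(Measure.infinitePi fun _ : ℕ => P) ∂P := by
  set cons : X × (ℕ → X) → ℕ → X := fun p k => Nat.casesOn k p.1 p.2 with hcons
  have hm : Measurable cons := by
    refine measurable_pi_lambda _ fun k => ?_
    cases k with
    | zero => exact measurable_fst
    | succ k => exact (measurable_pi_apply k).comp measurable_snd
  have key : (P.prod (Measure.infinitePi fun _ : ℕ => P)).map cons =
      Measure.infinitePi fun _ : ℕ => P := by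
    refine Measure.eq_infinitePi _ fun s t ht => ?_
    rw [Measure.map_apply hm (MeasurableSet.pi s.countable_toSet fun i _ => ht i)]
    -- `t'` extends the box over `s` to one over an initial segment, where the index can be shifted
    classical
    let t' : ℕ → Set X := fun i => if i ∈ s then t i else Set.univ
    have ht' : ∀ i, MeasurableSet (t' i) := fun i => by
      by_cases h : i ∈ s <;> simp [t', h, ht]
    obtain ⟨N, hN⟩ : ∃ N, s ⊆ Finset.range (N + 1) :=
      ⟨s.sup id, fun i hi => Finset.mem_range.2 (Nat.lt_succ_of_le (Finset.le_sup (f := id) hi))⟩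
    have hpre : cons ⁻¹' (Set.pi s t) =
        t' 0 ×ˢ Set.pi (Finset.range N) fun i => t' (i + 1) := by
      ext ⟨d, D⟩
      simp only [Set.mem_preimage, Set.mem_pi, Set.mem_prod, Finset.mem_coe, Finset.mem_range, t']
      constructor
      · intro h
        refine ⟨?_, fun i _ => ?_⟩
        · split_ifs with h0
          · exact h 0 h0
          · trivial
        · split_ifs with h0
          · exact h (i + 1) h0
          · trivial
      · rintro ⟨h0, h1⟩ i hi
        cases i with
        | zero =>
          rw [if_pos hi] at h0
          exact h0
        | succ i =>
          have := Finset.mem_range.1 (hN hi)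
          simpa [hi] using h1 i (by omega)
    rw [hpre, Measure.prod_prod, Measure.infinitePi_pi _ (fun i _ => ht' _),
      mul_comm, ← Finset.prod_range_succ' (fun i => P (t' i)), ← Finset.prod_subset hN]
    · exact Finset.prod_congr rfl fun i hi => by simp [t', hi]
    · intro i _ hi
      simp [t', hi]
  conv_lhs => rw [← key]
  rw [lintegral_map hG hm]
  exact lintegral_prod _ (hG.comp hm).aemeasurable

lemma lintegral_infinitePi_fin {X : Type*} [MeasurableSpace X] (P : Measure X)
    [IsProbabilityMeasure P] (n : ℕ) {G : (Fin n → X) → ℝ≥0∞} (hG : Measurable G) :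
    ∫⁻ D, G (fun i => D i) ∂(Measure.infinitePi fun _ : ℕ => P) =
      ∫⁻ v, G v ∂(Measure.pi fun _ : Fin n => P) := by
  have hm : Measurable (fun (D : ℕ → X) (i : Fin n) => D i) := by fun_prop
  have key : (Measure.pi fun _ : Fin n => P) =
      (Measure.infinitePi fun _ : ℕ => P).map (fun (D : ℕ → X) (i : Fin n) => D i) := by
    refine Measure.pi_eq fun s hs => ?_
    rw [Measure.map_apply hm (MeasurableSet.univ_pi hs)]
    let t : ℕ → Set X := fun i => if h : i < n then s ⟨i, h⟩ else Set.univ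
    have ht : ∀ i, MeasurableSet (t i) := fun i => by
      by_cases h : i < n <;> simp [t, h, hs]
    have hpre : (fun (D : ℕ → X) (i : Fin n) => D i) ⁻¹' (Set.pi Set.univ s) =
        Set.pi (Finset.range n) t := by
      ext D
      simp only [Set.mem_preimage, Set.mem_pi, Set.mem_univ, true_imp_iff, Finset.mem_coe,
        Finset.mem_range, t]
      exact ⟨fun h i hi => by simpa [hi] using h ⟨i, hi⟩,
        fun h i => by simpa using h i i.2⟩
    rw [hpre, Measure.infinitePi_pi _ (fun i _ => ht i), ← Fin.prod_univ_eq_prod_range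
      (fun i => P (t i))]
    exact Finset.prod_congr rfl fun i _ => by simp [t]
  rw [key, lintegral_map hG hm]

lemma lintegral_pi_insertNth {X : Type*} [MeasurableSpace X] (P : Measure X)
    [IsProbabilityMeasure P] {n : ℕ} (i : Fin (n + 1)) {G : (Fin (n + 1) → X) → ℝ≥0∞}
    (hG : Measurable G) :
    ∫⁻ v, G v ∂(Measure.pi fun _ : Fin (n + 1) => P) =
      ∫⁻ w, ∫⁻ v, G (Fin.insertNth (α := fun _ => X) i w v)
        ∂(Measure.pi fun _ : Fin n => P) ∂P := by
  have h := (measurePreserving_piFinSuccAbove (fun _ : Fin (n + 1) => P) i).symm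
  rw [← h.lintegral_comp hG]
  exact lintegral_prod _ (hG.comp h.measurable).aemeasurable

lemma pi_smul_const {X : Type*} [MeasurableSpace X] (P : Measure X)
    [IsProbabilityMeasure P] (n : ℕ) {c : ℝ≥0∞} (hc : c ≠ ∞) :
    (Measure.pi fun _ : Fin n => c • P) = c ^ n • (Measure.pi fun _ : Fin n => P) := by
  have := Measure.smul_finite P hc
  refine Measure.pi_eq fun s hs => ?_
  simp [Measure.pi_pi, Finset.prod_mul_distrib]

/-! ### The exponential distribution -/

lemma lintegral_expMeasure (r : ℝ) {f : ℝ → ℝ≥0∞} (hf : Measurable f) :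
    ∫⁻ x, f x ∂(expMeasure r) =
      ∫⁻ x in Set.Ici 0, ENNReal.ofReal (r * Real.exp (-(r * x))) * f x := by
  have hm : Measurable (exponentialPDF r) := (measurable_exponentialPDFReal r).ennreal_ofReal
  have h : expMeasure r = volume.withDensity (exponentialPDF r) := rfl
  rw [h, lintegral_withDensity_eq_lintegral_mul _ hm hf, ← lintegral_indicator measurableSet_Ici]
  refine lintegral_congr fun x => ?_
  by_cases hx : 0 ≤ x
  · simp [hx, exponentialPDF_of_nonneg hx]
  · simp [hx, exponentialPDF_of_neg (not_le.1 hx)]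

lemma nullSingletonClass_expMeasure (r : ℝ) : NullSingletonClass (expMeasure r) :=
  ⟨fun x => withDensity_absolutelyContinuous volume _ (measure_singleton x)⟩

lemma ae_nonneg_expMeasure (r : ℝ) : ∀ᵐ x ∂(expMeasure r), 0 ≤ x := by
  have h := lintegral_expMeasure r (f := (Set.Iio (0 : ℝ)).indicator 1)
    (measurable_one.indicator measurableSet_Iio)
  rw [lintegral_indicator_one measurableSet_Iio, setLIntegral_congr_fun (g := fun _ => 0)
    measurableSet_Ici] at h
  · rw [ae_iff]
    simpa [Set.Iio] using h
  · intro x hx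
    have : ¬ x < 0 := not_lt.2 hx
    simp [this]

/-- Memorylessness. -/
lemma map_sub_restrict_Ici_expMeasure (r : ℝ) {w : ℝ} (hw : 0 ≤ w) :
    ((expMeasure r).restrict (Set.Ici w)).map (fun x => x - w) =
      ENNReal.ofReal (Real.exp (-(r * w))) • expMeasure r := by
  refine Measure.ext_of_lintegral _ fun f hf => ?_
  rw [lintegral_map hf (by fun_prop), ← lintegral_indicator measurableSet_Ici,
    lintegral_expMeasure r (Measurable.indicator (by fun_prop) measurableSet_Ici),
    lintegral_smul_measure, smul_eq_mul, lintegral_expMeasure r hf,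
    ← lintegral_const_mul _ (by fun_prop), ← lintegral_indicator measurableSet_Ici,
    ← lintegral_indicator measurableSet_Ici, ← lintegral_add_right_eq_self _ w]
  refine lintegral_congr fun x => ?_
  by_cases hx : 0 ≤ x
  · have hxw : 0 ≤ x + w := by linarith
    have : r * Real.exp (-(r * (x + w))) = Real.exp (-(r * w)) * (r * Real.exp (-(r * x))) := by
      rw [mul_left_comm, ← Real.exp_add]; ring_nf
    simp [hx, hxw, this, ENNReal.ofReal_mul (Real.exp_nonneg _), mul_assoc]
  · simp [hx]

lemma map_sub_restrict_expMeasure (r : ℝ) {w : ℝ} (hw : 0 ≤ w) {S : Set ℝ}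
    (hS : S = Set.Ici w ∨ S = Set.Ioi w) :
    ((expMeasure r).restrict S).map (fun x => x - w) =
      ENNReal.ofReal (Real.exp (-(r * w))) • expMeasure r := by
  have := nullSingletonClass_expMeasure r
  rw [← map_sub_restrict_Ici_expMeasure r hw]
  rcases hS with rfl | rfl
  · rfl
  · rw [restrict_Ioi_eq_restrict_Ici]

lemma setLIntegral_sub_expMeasure (r : ℝ) {w : ℝ} (hw : 0 ≤ w) {S : Set ℝ}
    (hS : S = Set.Ici w ∨ S = Set.Ioi w) {f : ℝ → ℝ≥0∞} (hf : Measurable f) :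
    ∫⁻ x in S, f (x - w) ∂(expMeasure r) =
      ENNReal.ofReal (Real.exp (-(r * w))) * ∫⁻ x, f x ∂(expMeasure r) := by
  rw [← smul_eq_mul, ← lintegral_smul_measure, ← map_sub_restrict_expMeasure r hw hS,
    lintegral_map hf (by fun_prop)]

/-- Joint memorylessness: given that `n` independent exponential times all exceed `w`, their
excesses over `w` are again independent exponential times. Strict and weak inequalities may be
mixed. -/
lemma setLIntegral_pi_sub_expMeasure {r : ℝ} (hr : 0 < r) {w : ℝ} (hw : 0 ≤ w) (n : ℕ)
    {S : Fin n → Set ℝ} (hS : ∀ j, S j = Set.Ici w ∨ S j = Set.Ioi w)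
    {f : (Fin n → ℝ) → ℝ≥0∞} (hf : Measurable f) :
    ∫⁻ v in Set.pi Set.univ S, f (fun j => v j - w) ∂(Measure.pi fun _ => expMeasure r) =
      ENNReal.ofReal (Real.exp (-(n * (r * w)))) *
        ∫⁻ v, f v ∂(Measure.pi fun _ => expMeasure r) := by
  have := isProbabilityMeasure_expMeasure hr
  have hexp : ENNReal.ofReal (Real.exp (-(n * (r * w)))) =
      ENNReal.ofReal (Real.exp (-(r * w))) ^ n := by
    rw [← ENNReal.ofReal_pow (Real.exp_nonneg _), ← Real.exp_nat_mul]; ring_nf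
  rw [hexp, ← smul_eq_mul, ← lintegral_smul_measure, ← pi_smul_const _ _ ENNReal.ofReal_ne_top,
    Measure.restrict_pi_pi,
    ← lintegral_map (g := fun (v : Fin n → ℝ) j => v j - w) hf (by fun_prop),
    Measure.pi_map_pi (f := fun _ x => x - w) (fun j => by fun_prop)]
  simp_rw [map_sub_restrict_expMeasure r hw (hS _)]

/-- Change of rate: `a` times an exponential variable of rate `a * r` is exponential of rate `r`.
The variable of rate `a * r` appears through its density `a * exp (-(a - 1) * r * w)` with respect to
`expMeasure r`. -/
lemma lintegral_expMeasure_comp_mul {r : ℝ} (hr : 0 < r) {a : ℝ} (ha : 0 < a) {s : ℝ}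
    (hs : s = (a - 1) * r) {f : ℝ → ℝ≥0∞} (hf : Measurable f) :
    ENNReal.ofReal a * ∫⁻ w, ENNReal.ofReal (Real.exp (-(s * w))) * f (a * w) ∂(expMeasure r) =
      ∫⁻ y, f y ∂(expMeasure r) := by
  subst hs
  rw [lintegral_expMeasure r (by fun_prop), lintegral_expMeasure r hf,
    ← lintegral_indicator measurableSet_Ici, ← lintegral_indicator measurableSet_Ici]
  set g : ℝ → ℝ≥0∞ := (Set.Ici (0 : ℝ)).indicator
    fun y => ENNReal.ofReal (r * Real.exp (-(r * y))) * f y with hg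
  have hgm : Measurable g := Measurable.indicator (by fun_prop) measurableSet_Ici
  have hmap : ∫⁻ y, g y = ENNReal.ofReal a * ∫⁻ w, g (a * w) := by
    rw [← lintegral_map hgm (by fun_prop : Measurable fun w : ℝ => a * w),
      Real.map_volume_mul_left ha.ne', lintegral_smul_measure, smul_eq_mul, ← mul_assoc,
      ← ENNReal.ofReal_mul ha.le, abs_of_pos (inv_pos.2 ha), mul_inv_cancel₀ ha.ne']
    simp
  rw [hmap]
  congr 1
  refine lintegral_congr fun w => ?_
  by_cases hw : 0 ≤ w
  · have h2 : 0 ≤ a * w := by positivity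
    rw [hg, Set.indicator_of_mem (Set.mem_Ici.2 hw), Set.indicator_of_mem (Set.mem_Ici.2 h2),
      ← mul_assoc, ← ENNReal.ofReal_mul (by positivity), mul_assoc, ← Real.exp_add]
    ring_nf
  · have h2 : ¬ 0 ≤ a * w := by
      rw [mul_nonneg_iff_of_pos_left ha]; exact hw
    simp [hg, hw, h2]

/-! ### Systems driven by independent draws -/

/-- The state after `k` steps of a system that starts in `s` and is driven by the draws `D`. -/
def runFrom {S X : Type*} (step : S → X → S) (s : S) (D : ℕ → X) : ℕ → S
  | 0 => s
  | k + 1 => step (runFrom step s D k) (D k)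

lemma runFrom_cons {S X : Type*} (step : S → X → S) (s : S) (d : X) (D : ℕ → X) (k : ℕ) :
    runFrom step s (fun i => Nat.casesOn i d D) (k + 1) = runFrom step (step s d) D k := by
  induction k with
  | zero => rfl
  | succ k ih => rw [runFrom, ih, runFrom]

/-- The transition operator of the Markov chain that `step` defines when it is fed independent
draws with law `P`. -/
noncomputable def transOp {S X : Type*} [MeasurableSpace X] (P : Measure X) (step : S → X → S)
    (F : S → ℝ≥0∞) (s : S) : ℝ≥0∞ :=
  ∫⁻ d, F (step s d) ∂P

section

variable {S X : Type*} [MeasurableSpace S] [MeasurableSpace X] {P : Measure X}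
  [IsProbabilityMeasure P] {step : S → X → S}

lemma measurable_transOp (hstep : Measurable fun p : S × X => step p.1 p.2) {F : S → ℝ≥0∞}
    (hF : Measurable F) : Measurable (transOp P step F) :=
  Measurable.lintegral_prod_right' (f := fun p : S × X => F (step p.1 p.2)) (hF.comp hstep)

lemma measurable_iterate_transOp (hstep : Measurable fun p : S × X => step p.1 p.2)
    {F : S → ℝ≥0∞} (hF : Measurable F) (k : ℕ) : Measurable ((transOp P step)^[k] F) := by
  induction k with
  | zero => exact hF
  | succ k ih =>
    rw [Function.iterate_succ_apply']
    exact measurable_transOp hstep ih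

lemma measurable_runFrom (hstep : Measurable fun p : S × X => step p.1 p.2) (k : ℕ) :
    Measurable fun p : S × (ℕ → X) => runFrom step p.1 p.2 k := by
  induction k with
  | zero => exact measurable_fst
  | succ k ih => exact hstep.comp (ih.prodMk ((measurable_pi_apply k).comp measurable_snd))

/-- Markov property: averaging over the draws amounts to applying the transition operator. -/
lemma lintegral_runFrom (hstep : Measurable fun p : S × X => step p.1 p.2) {F : S → ℝ≥0∞}
    (hF : Measurable F) (k : ℕ) (s : S) :
    ∫⁻ D, F (runFrom step s D k) ∂(Measure.infinitePi fun _ : ℕ => P) =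
      (transOp P step)^[k] F s := by
  induction k generalizing s with
  | zero => simp [runFrom]
  | succ k ih =>
    have hm : Measurable fun D : ℕ → X => F (runFrom step s D (k + 1)) :=
      hF.comp ((measurable_runFrom hstep (k + 1)).comp measurable_prodMk_left)
    rw [lintegral_infinitePi_succ P hm, Function.iterate_succ_apply']
    exact lintegral_congr fun d =>
      (lintegral_congr fun D => congrArg F (runFrom_cons step s d D k)).trans (ih _)

end

/-! ### Measurability of the two queues -/

/-- The σ-algebra generated by the fields. -/
instance : MeasurableSpace PSState :=
  MeasurableSpace.comap (fun s => (s.clock, s.untilArrival, s.others, s.residual)) inferInstance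

/-- The σ-algebra generated by the fields. -/
instance : MeasurableSpace ROSState :=
  MeasurableSpace.comap (fun s => (s.clock, s.untilArrival, s.others, s.inService)) inferInstance

namespace PSState

lemma measurable_toProd :
    Measurable fun s : PSState => (s.clock, s.untilArrival, s.others, s.residual) :=
  comap_measurable _

@[fun_prop]
lemma measurable_clock : Measurable PSState.clock := measurable_toProd.fst

@[fun_prop]
lemma measurable_untilArrival : Measurable PSState.untilArrival := measurable_toProd.snd.fst

@[fun_prop]
lemma measurable_others : Measurable PSState.others := measurable_toProd.snd.snd.fst

@[fun_prop]
lemma measurable_residual : Measurable PSState.residual := measurable_toProd.snd.snd.snd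

lemma measurable_mk {α : Type*} [MeasurableSpace α] {c u : α → ℝ} {n : α → ℕ} {r : α → ℕ → ℝ}
    (hc : Measurable c) (hu : Measurable u) (hn : Measurable n) (hr : Measurable r) :
    Measurable fun a => PSState.mk (c a) (u a) (n a) (r a) :=
  measurable_comap_iff.2 (hc.prodMk (hu.prodMk (hn.prodMk hr)))

lemma next_mem (s : PSState) :
    s.next ∈ {i | i ≤ s.others ∧ ∀ j ≤ s.others, s.residual i ≤ s.residual j} := by
  refine Nat.sInf_mem ?_
  obtain ⟨i, hi, h⟩ := Finset.exists_min_image (Finset.range (s.others + 1)) s.residual ⟨0, by simp⟩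
  exact ⟨i, Nat.lt_succ_iff.1 (Finset.mem_range.1 hi),
    fun j hj => h j (Finset.mem_range.2 (Nat.lt_succ_of_le hj))⟩

/-- Customer `i` is next if it has a least requirement and all smaller numbers have a larger one. -/
lemma next_eq_iff (s : PSState) (i : ℕ) :
    s.next = i ↔ i ≤ s.others ∧ (∀ j ≤ s.others, s.residual i ≤ s.residual j) ∧
      ∀ j < i, s.residual i < s.residual j := by
  constructor
  · rintro rfl
    refine ⟨s.next_mem.1, s.next_mem.2, fun j hj => ?_⟩
    by_contra! hle
    exact Nat.notMem_of_lt_sInf hj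
      ⟨hj.le.trans s.next_mem.1, fun l hl => hle.trans (s.next_mem.2 l hl)⟩
  · rintro ⟨h1, h2, h3⟩
    refine le_antisymm (Nat.sInf_le ⟨h1, h2⟩) ?_
    by_contra! hlt
    exact (h3 _ hlt).not_ge (s.next_mem.2 i h1)

@[fun_prop]
lemma measurable_next : Measurable PSState.next := by
  refine measurable_to_countable' fun i => ?_
  have h : PSState.next ⁻¹' {i} = {s | i ≤ s.others} ∩
      ((⋂ j, {s | j ≤ s.others → s.residual i ≤ s.residual j}) ∩
        ⋂ j, {s | j < i → s.residual i < s.residual j}) := by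
    ext s
    simp [next_eq_iff]
  have hr : ∀ j, Measurable fun s : PSState => s.residual j := fun j => by fun_prop
  have ho : ∀ j, MeasurableSet {s : PSState | j ≤ s.others} := fun j =>
    measurableSet_le measurable_const measurable_others
  rw [h]
  refine (ho i).inter ((MeasurableSet.iInter fun j => ?_).inter (MeasurableSet.iInter fun j => ?_))
  · have : {s : PSState | j ≤ s.others → s.residual i ≤ s.residual j} =
        {s | j ≤ s.others}ᶜ ∪ {s | s.residual i ≤ s.residual j} := by
      ext s; simp [imp_iff_not_or]
    rw [this]
    exact (ho j).compl.union (measurableSet_le (hr i) (hr j))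
  · by_cases hj : j < i
    · simpa [hj] using measurableSet_lt (hr i) (hr j)
    · simp [hj]

lemma measurable_residual_next : Measurable fun s : PSState => s.residual s.next :=
  (measurable_from_prod_countable_right (f := fun p : ℕ × (ℕ → ℝ) => p.2 p.1)
    fun i => measurable_pi_apply i).comp (measurable_next.prodMk measurable_residual)

end PSState

namespace ROSState

lemma measurable_toProd :
    Measurable fun s : ROSState => (s.clock, s.untilArrival, s.others, s.inService) :=
  comap_measurable _

@[fun_prop]
lemma measurable_clock : Measurable ROSState.clock := measurable_toProd.fst

@[fun_prop]
lemma measurable_untilArrival : Measurable ROSState.untilArrival := measurable_toProd.snd.fst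

@[fun_prop]
lemma measurable_others : Measurable ROSState.others := measurable_toProd.snd.snd.fst

@[fun_prop]
lemma measurable_inService : Measurable ROSState.inService := measurable_toProd.snd.snd.snd

lemma measurable_mk {α : Type*} [MeasurableSpace α] {c u s : α → ℝ} {n : α → ℕ}
    (hc : Measurable c) (hu : Measurable u) (hn : Measurable n) (hs : Measurable s) :
    Measurable fun a => ROSState.mk (c a) (u a) (n a) (s a) :=
  measurable_comap_iff.2 (hc.prodMk (hu.prodMk (hn.prodMk hs)))

end ROSState

@[fun_prop]
lemma Draw.measurable_gap : Measurable Draw.gap := measurable_fst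

@[fun_prop]
lemma Draw.measurable_work : Measurable Draw.work := measurable_snd.fst

@[fun_prop]
lemma Draw.measurable_mark : Measurable Draw.mark := measurable_snd.snd.fst

@[fun_prop]
lemma Draw.measurable_pick : Measurable Draw.pick := measurable_snd.snd.snd

lemma measurable_sum_prod {α β γ δ : Type*} [MeasurableSpace α] [MeasurableSpace β]
    [MeasurableSpace γ] [MeasurableSpace δ] {f : (α ⊕ β) × γ → δ}
    (hl : Measurable fun p : α × γ => f (Sum.inl p.1, p.2))
    (hr : Measurable fun p : β × γ => f (Sum.inr p.1, p.2)) : Measurable f := by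
  rw [← (MeasurableEquiv.sumProdDistrib α β γ).symm.measurable_comp_iff]
  exact measurable_fun_sum hl hr

lemma measurable_psStep (b : ℕ → ℝ) :
    Measurable fun p : (PSState ⊕ ℝ) × Draw => psStep b p.1 p.2 := by
  classical
  have hcast : Measurable fun p : PSState × Draw => ((p.1.others : ℝ) + 1) :=
    (((measurable_of_countable fun n : ℕ => ((n : ℝ) + 1)).comp PSState.measurable_others).comp
      measurable_fst)
  have hb : Measurable fun p : PSState × Draw => b (p.1.others + 1) :=
    ((measurable_of_countable fun n : ℕ => b (n + 1)).comp PSState.measurable_others).comp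
      measurable_fst
  have hw : Measurable fun p : PSState × Draw => p.1.residual p.1.next :=
    PSState.measurable_residual_next.comp measurable_fst
  have hr : ∀ j, Measurable fun p : PSState × Draw => p.1.residual j := fun j => by fun_prop
  have ho1 : Measurable fun p : PSState × Draw => p.1.others + 1 := by fun_prop
  have ho2 : Measurable fun p : PSState × Draw => p.1.others - 1 := by fun_prop
  have hnext : Measurable fun p : PSState × Draw => p.1.next := by fun_prop
  refine measurable_sum_prod ?_ (measurable_inr.comp measurable_fst)
  simp only [psStep]
  refine Measurable.ite (measurableSet_le (hcast.mul hw) (by fun_prop)) ?_ ?_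
  · refine Measurable.ite (measurableSet_eq_fun hnext measurable_const)
      (measurable_inr.comp (by fun_prop)) (measurable_inl.comp ?_)
    refine PSState.measurable_mk (by fun_prop) (by fun_prop) ho2
      (measurable_pi_lambda _ fun j => ?_)
    exact Measurable.ite (measurableSet_lt measurable_const hnext)
      ((hr j).sub hw) ((hr (j + 1)).sub hw)
  · refine Measurable.ite (measurableSet_lt (by fun_prop) hb) (measurable_inl.comp ?_)
      (measurable_inl.comp ?_)
    · refine PSState.measurable_mk (by fun_prop) (by fun_prop) ho1
        (measurable_pi_lambda _ fun j => ?_)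
      simp only [Function.update_apply]
      exact Measurable.ite (measurableSet_eq_fun measurable_const ho1) (by fun_prop) (by fun_prop)
    · refine PSState.measurable_mk (by fun_prop) (by fun_prop) (by fun_prop)
        (measurable_pi_lambda _ fun j => by fun_prop)

lemma measurable_rosStep (br : ℕ → ℝ) :
    Measurable fun p : (ROSState ⊕ ℝ) × Draw => rosStep br p.1 p.2 := by
  classical
  have hcast : Measurable fun p : ROSState × Draw => ((p.1.others : ℝ) + 1) :=
    (((measurable_of_countable fun n : ℕ => ((n : ℝ) + 1)).comp ROSState.measurable_others).comp
      measurable_fst)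
  have hb : Measurable fun p : ROSState × Draw => br (p.1.others + 2) :=
    ((measurable_of_countable fun n : ℕ => br (n + 2)).comp ROSState.measurable_others).comp
      measurable_fst
  have ho1 : Measurable fun p : ROSState × Draw => p.1.others + 1 := by fun_prop
  have ho2 : Measurable fun p : ROSState × Draw => p.1.others - 1 := by fun_prop
  have hf : Measurable fun p : ROSState × Draw => ⌊p.2.pick * (p.1.others + 1)⌋₊ :=
    Nat.measurable_floor.comp (by fun_prop)
  refine measurable_sum_prod ?_ (measurable_inr.comp measurable_fst)
  simp only [rosStep]
  refine Measurable.ite (measurableSet_le (by fun_prop) (by fun_prop)) ?_ (measurable_inl.comp ?_)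
  · exact Measurable.ite (measurableSet_eq_fun hf measurable_const)
      (measurable_inr.comp (by fun_prop)) (measurable_inl.comp
        (ROSState.measurable_mk (by fun_prop) (by fun_prop) ho2 (by fun_prop)))
  · exact ROSState.measurable_mk (by fun_prop) (by fun_prop)
      (Measurable.ite (measurableSet_lt (by fun_prop) hb) ho1 (by fun_prop)) (by fun_prop)

/-! ### Irrelevant coordinates -/

/-- The two states differ at most in residual requirements of customers that are not there. -/
structure PSState.Agree (s s' : PSState) : Prop where
  clock : s.clock = s'.clock
  untilArrival : s.untilArrival = s'.untilArrival
  others : s.others = s'.others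
  residual : ∀ j ≤ s.others, s.residual j = s'.residual j

lemma PSState.Agree.next {s s' : PSState} (h : s.Agree s') : s.next = s'.next := by
  rw [PSState.next_eq_iff, h.others, h.residual _ (h.others ▸ s'.next_mem.1)]
  have h' := (PSState.next_eq_iff s' _).1 rfl
  refine ⟨h'.1, fun j hj => ?_, fun j hj => ?_⟩
  · rw [h.residual j (h.others ▸ hj)]; exact h'.2.1 j hj
  · rw [h.residual j (h.others ▸ hj.le.trans h'.1)]; exact h'.2.2 j hj

/-- The dynamics do not read the residual requirements of absent customers: a completion shifts only
present ones, and an arrival overwrites the first absent one. -/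
lemma PSState.Agree.psStep {s s' : PSState} (h : s.Agree s') (b : ℕ → ℝ) (d : Draw) :
    Sum.LiftRel PSState.Agree Eq (psStep b (Sum.inl s) d) (psStep b (Sum.inl s') d) := by
  have hn := h.next
  have hle : s.next ≤ s.others := s.next_mem.1
  have hw : s.residual s.next = s'.residual s'.next := by rw [← hn, h.residual _ hle]
  have hr := h.residual
  obtain ⟨h1, h2, h3, -⟩ := h
  simp only [_root_.psStep, ← hn, ← h1, ← h2, ← h3]
  rw [← hn] at hw
  simp only [← hw]
  split_ifs with h4 h5 h6
  · exact Sum.LiftRel.inr rfl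
  · refine Sum.LiftRel.inl ⟨rfl, rfl, rfl, fun j hj => ?_⟩
    dsimp only at hj ⊢
    rw [hr j (by omega), hr (j + 1) (by omega)]
  · refine Sum.LiftRel.inl ⟨rfl, rfl, rfl, fun j hj => ?_⟩
    dsimp only at hj ⊢
    by_cases hj' : j = s.others + 1
    · simp [hj']
    · simp [hj', hr j (by omega)]
  · refine Sum.LiftRel.inl ⟨rfl, rfl, rfl, fun j hj => ?_⟩
    dsimp only at hj ⊢
    rw [hr j hj]

/-- `F` ignores the residual requirements of customers that are not there. -/
def RespectsAgree (F : PSState ⊕ ℝ → ℝ≥0∞) : Prop :=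
  ∀ s s' : PSState, s.Agree s' → F (Sum.inl s) = F (Sum.inl s')

lemma RespectsAgree.transOp {F : PSState ⊕ ℝ → ℝ≥0∞} (hF : RespectsAgree F) (P : Measure Draw)
    (b : ℕ → ℝ) : RespectsAgree (transOp P (psStep b) F) := by
  intro s s' h
  refine lintegral_congr fun d => ?_
  have h' := h.psStep b d
  revert h'
  generalize psStep b (Sum.inl s) d = x
  generalize psStep b (Sum.inl s') d = y
  rintro (h' | h')
  · exact hF _ _ h'
  · rw [h']

/-! ### Integrals over one draw -/

instance : IsProbabilityMeasure uniform01 :=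
  ⟨by simp [uniform01]⟩

lemma isProbabilityMeasure_drawLaw {lam mu : ℝ} (hlam : 0 < lam) (hmu : 0 < mu) :
    IsProbabilityMeasure (drawLaw lam mu) := by
  have := isProbabilityMeasure_expMeasure hlam
  have := isProbabilityMeasure_expMeasure hmu
  unfold drawLaw
  infer_instance

lemma isProbabilityMeasure_sampleLaw {lam mu : ℝ} (hlam : 0 < lam) (hmu : 0 < mu) :
    IsProbabilityMeasure (sampleLaw lam mu) := by
  have := isProbabilityMeasure_expMeasure hlam
  have := isProbabilityMeasure_expMeasure hmu
  have := isProbabilityMeasure_drawLaw hlam hmu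
  unfold sampleLaw
  infer_instance

lemma uniform01_Iio {β : ℝ} (hβ : β ∈ Set.Icc (0 : ℝ) 1) :
    uniform01 (Set.Iio β) = ENNReal.ofReal β := by
  rw [uniform01, Measure.restrict_apply measurableSet_Iio]
  have : Set.Iio β ∩ Set.Icc 0 1 = Set.Ico 0 β := by
    ext x
    simp only [Set.mem_inter_iff, Set.mem_Iio, Set.mem_Icc, Set.mem_Ico]
    exact ⟨fun h => ⟨h.2.1, h.1⟩, fun h => ⟨h.2, h.1, h.2.le.trans hβ.2⟩⟩
  rw [this, Real.volume_Ico, sub_zero]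

open Classical in
lemma lintegral_uniform01_ite {β : ℝ} (hβ : β ∈ Set.Icc (0 : ℝ) 1) (a a' : ℝ≥0∞) :
    ∫⁻ m, (if m < β then a else a') ∂uniform01 =
      ENNReal.ofReal β * a + ENNReal.ofReal (1 - β) * a' := by
  have hc : uniform01 (Set.Iio β)ᶜ = ENNReal.ofReal (1 - β) := by
    rw [prob_compl_eq_one_sub measurableSet_Iio, uniform01_Iio hβ, ENNReal.ofReal_sub _ hβ.1,
      ENNReal.ofReal_one]
  have h : ∀ m : ℝ, (if m < β then a else a') =
      (Set.Iio β).indicator (fun _ => a) m + (Set.Iio β)ᶜ.indicator (fun _ => a') m := by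
    intro m
    by_cases hm : m < β
    · simp [hm]
    · simp [hm, not_lt.1 hm]
  simp_rw [h]
  rw [lintegral_add_left (measurable_const.indicator measurableSet_Iio),
    lintegral_indicator_const measurableSet_Iio,
    lintegral_indicator_const measurableSet_Iio.compl, hc, uniform01_Iio hβ, mul_comm a,
    mul_comm a']

lemma one_div_succ_mem_Icc (n : ℕ) : 1 / ((n : ℝ) + 1) ∈ Set.Icc (0 : ℝ) 1 :=
  ⟨by positivity, by rw [div_le_one (by positivity)]; linarith [Nat.cast_nonneg (α := ℝ) n]⟩

open Classical in
lemma lintegral_uniform01_floor (n : ℕ) (a a' : ℝ≥0∞) :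
    ∫⁻ p, (if ⌊p * ((n : ℝ) + 1)⌋₊ = 0 then a else a') ∂uniform01 =
      ENNReal.ofReal (1 / ((n : ℝ) + 1)) * a + ENNReal.ofReal (1 - 1 / ((n : ℝ) + 1)) * a' := by
  rw [← lintegral_uniform01_ite (one_div_succ_mem_Icc n)]
  have hn : (0 : ℝ) < (n : ℝ) + 1 := by positivity
  refine lintegral_congr fun p => ?_
  simp only [Nat.floor_eq_zero, lt_div_iff₀ hn]

section

variable {lam mu : ℝ}

lemma lintegral_drawLaw (hlam : 0 < lam) (hmu : 0 < mu) {G : Draw → ℝ≥0∞} (hG : Measurable G) :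
    ∫⁻ d, G d ∂(drawLaw lam mu) =
      ∫⁻ g, ∫⁻ w, ∫⁻ m, ∫⁻ p, G (g, w, m, p) ∂uniform01 ∂uniform01 ∂(expMeasure mu)
        ∂(expMeasure lam) := by
  have := isProbabilityMeasure_expMeasure hlam
  have := isProbabilityMeasure_expMeasure hmu
  rw [drawLaw, lintegral_prod _ hG.aemeasurable]
  refine lintegral_congr fun g => ?_
  rw [lintegral_prod _ (by fun_prop)]
  refine lintegral_congr fun w => ?_
  rw [lintegral_prod _ (by fun_prop)]

open Classical in
lemma lintegral_drawLaw_mark (hlam : 0 < lam) (hmu : 0 < mu) {β : ℝ}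
    (hβ : β ∈ Set.Icc (0 : ℝ) 1) {X Y : ℝ → ℝ → ℝ≥0∞} (hX : Measurable (Function.uncurry X))
    (hY : Measurable (Function.uncurry Y)) :
    ∫⁻ d : Draw, (if d.mark < β then X d.gap d.work else Y d.gap d.work) ∂(drawLaw lam mu) =
      ENNReal.ofReal β * ∫⁻ g, ∫⁻ w, X g w ∂(expMeasure mu) ∂(expMeasure lam) +
        ENNReal.ofReal (1 - β) * ∫⁻ g, ∫⁻ w, Y g w ∂(expMeasure mu) ∂(expMeasure lam) := by
  have := isProbabilityMeasure_expMeasure hlam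
  have := isProbabilityMeasure_expMeasure hmu
  have hX' : Measurable fun d : Draw => X d.gap d.work :=
    hX.comp (Draw.measurable_gap.prodMk Draw.measurable_work)
  have hY' : Measurable fun d : Draw => Y d.gap d.work :=
    hY.comp (Draw.measurable_gap.prodMk Draw.measurable_work)
  have hXi : Measurable fun g => ∫⁻ w, X g w ∂(expMeasure mu) := hX.lintegral_prod_right
  have hYi : Measurable fun g => ∫⁻ w, Y g w ∂(expMeasure mu) := hY.lintegral_prod_right
  have hX1 : ∀ g, Measurable (X g) := fun g => hX.comp measurable_prodMk_left
  have hY1 : ∀ g, Measurable (Y g) := fun g => hY.comp measurable_prodMk_left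
  rw [lintegral_drawLaw hlam hmu
    (Measurable.ite (measurableSet_lt (by fun_prop) measurable_const) hX' hY')]
  have hm : ∀ g w, ∫⁻ m, ∫⁻ p, (if Draw.mark (g, w, m, p) < β then
        X (Draw.gap (g, w, m, p)) (Draw.work (g, w, m, p)) else
        Y (Draw.gap (g, w, m, p)) (Draw.work (g, w, m, p))) ∂uniform01 ∂uniform01 =
      ENNReal.ofReal β * X g w + ENNReal.ofReal (1 - β) * Y g w := fun g w => by
    rw [← lintegral_uniform01_ite hβ]
    exact lintegral_congr fun m =>
      (lintegral_const (μ := uniform01) (if m < β then X g w else Y g w)).trans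
        (by rw [measure_univ, mul_one])
  simp_rw [hm]
  rw [← lintegral_const_mul _ hXi, ← lintegral_const_mul _ hYi,
    ← lintegral_add_left (hXi.const_mul _)]
  refine lintegral_congr fun g => ?_
  rw [← lintegral_const_mul _ (hX1 g), ← lintegral_const_mul _ (hY1 g),
    ← lintegral_add_left ((hX1 g).const_mul _)]

open Classical in
lemma lintegral_drawLaw_pick (hlam : 0 < lam) (hmu : 0 < mu) (n : ℕ) (a : ℝ≥0∞)
    {X : ℝ → ℝ≥0∞} (hX : Measurable X) :
    ∫⁻ d : Draw, (if ⌊d.pick * ((n : ℝ) + 1)⌋₊ = 0 then a else X d.work) ∂(drawLaw lam mu) =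
      ENNReal.ofReal (1 / ((n : ℝ) + 1)) * a +
        ENNReal.ofReal (1 - 1 / ((n : ℝ) + 1)) * ∫⁻ w, X w ∂(expMeasure mu) := by
  have := isProbabilityMeasure_expMeasure hlam
  have := isProbabilityMeasure_expMeasure hmu
  have hf : Measurable fun d : Draw => ⌊d.pick * ((n : ℝ) + 1)⌋₊ :=
    Nat.measurable_floor.comp (by fun_prop)
  have hX' : Measurable fun d : Draw => X d.work := hX.comp Draw.measurable_work
  rw [lintegral_drawLaw hlam hmu
    (Measurable.ite (measurableSet_eq_fun hf measurable_const) measurable_const hX')]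
  have hp : ∀ g w, ∫⁻ m, ∫⁻ p, (if ⌊Draw.pick (g, w, m, p) * ((n : ℝ) + 1)⌋₊ = 0 then a else
        X (Draw.work (g, w, m, p))) ∂uniform01 ∂uniform01 =
      ENNReal.ofReal (1 / ((n : ℝ) + 1)) * a +
        ENNReal.ofReal (1 - 1 / ((n : ℝ) + 1)) * X w := fun g w => by
    rw [← lintegral_uniform01_floor]
    exact (lintegral_const (μ := uniform01)
      (∫⁻ p, (if ⌊p * ((n : ℝ) + 1)⌋₊ = 0 then a else X w) ∂uniform01)).trans
        (by rw [measure_univ, mul_one])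
  simp_rw [hp]
  simp only [lintegral_const, measure_univ, mul_one]
  rw [lintegral_add_left measurable_const, lintegral_const_mul _ hX]
  simp

/-! ### The recursion over one event -/

/-- The value `c, n ↦ V c n` of a system before one more event, where `n` others are present at
time `c`: at the first event, a completion after time `y` removes the tagged customer with
probability `1 / (n + 1)` and another one otherwise; an arrival after time `x` joins with
probability `β`. Each of the factors `exp` is the probability that the other kind of event has not
come earlier. -/
noncomputable def eventValue (lam mu β : ℝ) (n : ℕ) (f : ℝ → ℝ≥0∞) (V : ℝ → ℕ → ℝ≥0∞) (c : ℝ) :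
    ℝ≥0∞ :=
  ∫⁻ y, ENNReal.ofReal (Real.exp (-(lam * y))) *
    (ENNReal.ofReal (1 / ((n : ℝ) + 1)) * f (c + y) +
      ENNReal.ofReal (1 - 1 / ((n : ℝ) + 1)) * V (c + y) (n - 1)) ∂(expMeasure mu) +
  ∫⁻ x, ENNReal.ofReal (Real.exp (-(mu * x))) *
    (ENNReal.ofReal β * V (c + x) (n + 1) + ENNReal.ofReal (1 - β) * V (c + x) n)
      ∂(expMeasure lam)

/-! ### Random order of service -/

/-- The mean of `F` over the states of the random-order-of-service queue at time `c` with `n` other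
waiting customers, when the two running clocks are exponential. -/
noncomputable def rosValue (lam mu : ℝ) (F : ROSState ⊕ ℝ → ℝ≥0∞) (c : ℝ) (n : ℕ) : ℝ≥0∞ :=
  ∫⁻ u, ∫⁻ s, F (Sum.inl ⟨c, u, n, s⟩) ∂(expMeasure mu) ∂(expMeasure lam)

open Classical in
/-- Two competing exponential clocks, of which the later one is read again when the first one
rings. -/
lemma lintegral_competing (hlam : 0 < lam) (hmu : 0 < mu) {A B : ℝ → ℝ → ℝ≥0∞}
    (hA : Measurable (Function.uncurry A)) (hB : Measurable (Function.uncurry B)) :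
    ∫⁻ u, ∫⁻ s, (if s ≤ u then A s (u - s) else B u (s - u)) ∂(expMeasure mu) ∂(expMeasure lam) =
      ∫⁻ s, ENNReal.ofReal (Real.exp (-(lam * s))) * ∫⁻ u, A s u ∂(expMeasure lam)
        ∂(expMeasure mu) +
      ∫⁻ u, ENNReal.ofReal (Real.exp (-(mu * u))) * ∫⁻ s, B u s ∂(expMeasure mu)
        ∂(expMeasure lam) := by
  have := isProbabilityMeasure_expMeasure hlam
  have := isProbabilityMeasure_expMeasure hmu
  have hA' : Measurable fun p : ℝ × ℝ => if p.2 ≤ p.1 then A p.2 (p.1 - p.2) else 0 :=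
    Measurable.ite (measurableSet_le measurable_snd measurable_fst)
      (hA.comp (measurable_snd.prodMk (measurable_fst.sub measurable_snd))) measurable_const
  have hsplit : ∀ u s, (if s ≤ u then A s (u - s) else B u (s - u)) =
      (if s ≤ u then A s (u - s) else 0) + (if u < s then B u (s - u) else 0) := by
    intro u s
    by_cases h : s ≤ u
    · simp [h, not_lt.2 h]
    · simp [h, not_le.1 h]
  have h1 : ∀ u, ∫⁻ s, (if s ≤ u then A s (u - s) else B u (s - u)) ∂(expMeasure mu) =
      ∫⁻ s, (if s ≤ u then A s (u - s) else 0) ∂(expMeasure mu) +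
        ∫⁻ s, (if u < s then B u (s - u) else 0) ∂(expMeasure mu) := fun u => by
    simp_rw [hsplit u]
    exact lintegral_add_left (hA'.comp measurable_prodMk_left) _
  simp_rw [h1]
  rw [lintegral_add_left hA'.lintegral_prod_right, lintegral_lintegral_swap hA'.aemeasurable]
  congr 1
  · refine lintegral_congr_ae ?_
    filter_upwards [ae_nonneg_expMeasure mu] with s hs
    rw [← setLIntegral_sub_expMeasure lam hs (Or.inl rfl) (hA.of_uncurry_left (x := s)),
      ← lintegral_indicator measurableSet_Ici]
    refine lintegral_congr fun u => ?_
    simp [Set.indicator_apply]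
  · refine lintegral_congr_ae ?_
    filter_upwards [ae_nonneg_expMeasure lam] with u hu
    rw [← setLIntegral_sub_expMeasure mu hu (Or.inr rfl) (hB.of_uncurry_left (x := u)),
      ← lintegral_indicator measurableSet_Ioi]
    refine lintegral_congr fun s => ?_
    simp [Set.indicator_apply]

/-- The mean of `F` after one more event of the random-order-of-service queue. -/
lemma rosValue_transOp (hlam : 0 < lam) (hmu : 0 < mu) {br : ℕ → ℝ} {n : ℕ}
    (hbr : br (n + 2) ∈ Set.Icc (0 : ℝ) 1) {F : ROSState ⊕ ℝ → ℝ≥0∞} (hF : Measurable F) (c : ℝ) :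
    rosValue lam mu (transOp (drawLaw lam mu) (rosStep br) F) c n =
      eventValue lam mu (br (n + 2)) n (fun τ => F (Sum.inr τ)) (rosValue lam mu F) c := by
  classical
  have := isProbabilityMeasure_expMeasure hlam
  have := isProbabilityMeasure_expMeasure hmu
  have := isProbabilityMeasure_drawLaw hlam hmu
  have hFl : ∀ m, Measurable fun p : ℝ × ℝ × ℝ => F (Sum.inl ⟨p.1, p.2.1, m, p.2.2⟩) := fun m =>
    hF.comp (measurable_inl.comp (ROSState.measurable_mk (by fun_prop) (by fun_prop)
      (by fun_prop) (by fun_prop)))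
  have hFr : Measurable fun τ : ℝ => F (Sum.inr τ) := hF.comp measurable_inr
  have hf : Measurable fun d : Draw => ⌊d.pick * ((n : ℝ) + 1)⌋₊ :=
    Nat.measurable_floor.comp (by fun_prop)
  let A : ℝ → ℝ → ℝ≥0∞ := fun s u => ∫⁻ d : Draw, (if ⌊d.pick * ((n : ℝ) + 1)⌋₊ = 0 then
    F (Sum.inr (c + s)) else F (Sum.inl ⟨c + s, u, n - 1, d.work⟩)) ∂(drawLaw lam mu)
  let B : ℝ → ℝ → ℝ≥0∞ := fun u s => ∫⁻ d : Draw, (if d.mark < br (n + 2) then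
    F (Sum.inl ⟨c + u, d.gap, n + 1, s⟩) else F (Sum.inl ⟨c + u, d.gap, n, s⟩)) ∂(drawLaw lam mu)
  have hA : Measurable (Function.uncurry A) := by
    refine Measurable.lintegral_prod_right' (f := fun p : (ℝ × ℝ) × Draw =>
      (if ⌊p.2.pick * ((n : ℝ) + 1)⌋₊ = 0 then
      F (Sum.inr (c + p.1.1)) else F (Sum.inl ⟨c + p.1.1, p.1.2, n - 1, p.2.work⟩))) ?_
    exact Measurable.ite (measurableSet_eq_fun (hf.comp measurable_snd) measurable_const)
      (hFr.comp (by fun_prop)) ((hFl (n - 1)).comp (by fun_prop :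
        Measurable fun p : (ℝ × ℝ) × Draw => (c + p.1.1, p.1.2, p.2.work)))
  have hB : Measurable (Function.uncurry B) := by
    refine Measurable.lintegral_prod_right' (f := fun p : (ℝ × ℝ) × Draw =>
      (if p.2.mark < br (n + 2) then F (Sum.inl ⟨c + p.1.1, p.2.gap, n + 1, p.1.2⟩)
        else F (Sum.inl ⟨c + p.1.1, p.2.gap, n, p.1.2⟩))) ?_
    exact Measurable.ite (measurableSet_lt (by fun_prop) measurable_const)
      ((hFl (n + 1)).comp (by fun_prop :
        Measurable fun p : (ℝ × ℝ) × Draw => (c + p.1.1, p.2.gap, p.1.2)))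
      ((hFl n).comp (by fun_prop :
        Measurable fun p : (ℝ × ℝ) × Draw => (c + p.1.1, p.2.gap, p.1.2)))
  have hstep : ∀ u s, transOp (drawLaw lam mu) (rosStep br) F (Sum.inl ⟨c, u, n, s⟩) =
      if s ≤ u then A s (u - s) else B u (s - u) := by
    intro u s
    by_cases h : s ≤ u
    · simp only [transOp, rosStep, h, if_true, A]
      refine lintegral_congr fun d => ?_
      split_ifs <;> rfl
    · simp only [transOp, rosStep, h, if_false, B]
      refine lintegral_congr fun d => ?_
      split_ifs <;> rfl
  unfold rosValue
  simp_rw [hstep]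
  rw [lintegral_competing hlam hmu hA hB, eventValue]
  congr 1
  · refine lintegral_congr fun s => ?_
    congr 1
    have hi : Measurable fun u : ℝ => ∫⁻ w, F (Sum.inl ⟨c + s, u, n - 1, w⟩) ∂(expMeasure mu) :=
      Measurable.lintegral_prod_right' (f := fun p : ℝ × ℝ =>
        F (Sum.inl ⟨c + s, p.1, n - 1, p.2⟩)) ((hFl (n - 1)).comp (by fun_prop :
          Measurable fun p : ℝ × ℝ => (c + s, p.1, p.2)))
    have : ∀ u, A s u = ENNReal.ofReal (1 / ((n : ℝ) + 1)) * F (Sum.inr (c + s)) +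
        ENNReal.ofReal (1 - 1 / ((n : ℝ) + 1)) *
          ∫⁻ w, F (Sum.inl ⟨c + s, u, n - 1, w⟩) ∂(expMeasure mu) := fun u =>
      lintegral_drawLaw_pick hlam hmu n _ ((hFl (n - 1)).comp (by fun_prop :
        Measurable fun w : ℝ => (c + s, u, w)))
    simp_rw [this]
    rw [lintegral_add_left measurable_const, lintegral_const_mul _ hi]
    simp
  · refine lintegral_congr fun u => ?_
    congr 1
    have hi : ∀ m, Measurable fun p : ℝ × ℝ => F (Sum.inl ⟨c + u, p.2, m, p.1⟩) := fun m =>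
      (hFl m).comp (by fun_prop : Measurable fun p : ℝ × ℝ => (c + u, p.2, p.1))
    have : ∀ s, B u s = ENNReal.ofReal (br (n + 2)) *
          ∫⁻ g, F (Sum.inl ⟨c + u, g, n + 1, s⟩) ∂(expMeasure lam) +
        ENNReal.ofReal (1 - br (n + 2)) *
          ∫⁻ g, F (Sum.inl ⟨c + u, g, n, s⟩) ∂(expMeasure lam) := fun s => by
      have := lintegral_drawLaw_mark hlam hmu hbr
        (X := fun g _ => F (Sum.inl ⟨c + u, g, n + 1, s⟩))
        (Y := fun g _ => F (Sum.inl ⟨c + u, g, n, s⟩))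
        ((hi (n + 1)).comp (by fun_prop : Measurable fun p : ℝ × ℝ => (s, p.1)))
        ((hi n).comp (by fun_prop : Measurable fun p : ℝ × ℝ => (s, p.1)))
      simpa using this
    simp_rw [this]
    rw [lintegral_add_left ((hi (n + 1)).lintegral_prod_right'.const_mul _),
      lintegral_const_mul _ (hi (n + 1)).lintegral_prod_right',
      lintegral_const_mul _ (hi n).lintegral_prod_right',
      lintegral_lintegral_swap
        (f := fun s g => F (Sum.inl ⟨c + u, g, n + 1, s⟩)) (hi (n + 1)).aemeasurable,
      lintegral_lintegral_swap
        (f := fun s g => F (Sum.inl ⟨c + u, g, n, s⟩)) (hi n).aemeasurable]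

end

/-! ### Processor sharing -/

/-- The sequence of residual requirements that starts with the vector `v`, filled up with `0`. -/
noncomputable def padZero {n : ℕ} (v : Fin n → ℝ) (j : ℕ) : ℝ := if h : j < n then v ⟨j, h⟩ else 0

lemma padZero_of_lt {n : ℕ} (v : Fin n → ℝ) {j : ℕ} (h : j < n) : padZero v j = v ⟨j, h⟩ :=
  dif_pos h

@[simp]
lemma padZero_val {n : ℕ} (v : Fin n → ℝ) (j : Fin n) : padZero v j = v j :=
  padZero_of_lt v j.2

@[fun_prop]
lemma measurable_padZero {n : ℕ} : Measurable (padZero (n := n)) := by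
  refine measurable_pi_lambda _ fun j => ?_
  by_cases h : j < n
  · simpa [padZero, h] using measurable_pi_apply _
  · simp [padZero, h]

lemma update_padZero {n : ℕ} (v : Fin n → ℝ) (w : ℝ) :
    Function.update (padZero v) n w =
      padZero (Fin.insertNth (α := fun _ => ℝ) (Fin.last n) w v) := by
  funext j
  rw [Fin.insertNth_last']
  rcases lt_trichotomy j n with h | rfl | h
  · rw [Function.update_of_ne h.ne, padZero_of_lt _ h, padZero_of_lt _ (h.trans n.lt_succ_self)]
    exact (Fin.snoc_castSucc (α := fun _ => ℝ) (n := n) w v ⟨j, h⟩).symm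
  · rw [Function.update_self, padZero_of_lt _ j.lt_succ_self]
    exact (Fin.snoc_last (α := fun _ => ℝ) w v).symm
  · rw [Function.update_of_ne h.ne']
    simp [padZero, not_lt.2 h.le, show ¬ j < n + 1 by omega]

/-- The set of values of the `j`-th of the customers other than `i` that are compatible with
customer `i` completing first, with requirement `w`: ties are won by the smaller number. -/
def laterSet {n : ℕ} (i : Fin (n + 1)) (w : ℝ) (j : Fin n) : Set ℝ :=
  if i.succAbove j < i then Set.Ioi w else Set.Ici w

lemma laterSet_eq {n : ℕ} (i : Fin (n + 1)) (w : ℝ) (j : Fin n) :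
    laterSet i w j = Set.Ici w ∨ laterSet i w j = Set.Ioi w := by
  unfold laterSet
  split_ifs <;> simp

lemma next_eq_iff_mem_laterSet {n : ℕ} (c u : ℝ) (v : Fin (n + 1) → ℝ) (i : Fin (n + 1)) :
    (PSState.mk c u n (padZero v)).next = i ↔ ∀ j, v (i.succAbove j) ∈ laterSet i (v i) j := by
  rw [PSState.next_eq_iff]
  dsimp only
  constructor
  · rintro ⟨-, h2, h3⟩ j
    unfold laterSet
    split_ifs with h
    · simpa using h3 (i.succAbove j) h
    · simpa using h2 (i.succAbove j) (Nat.lt_succ_iff.1 (i.succAbove j).2)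
  · intro h
    have hlt : ∀ j : Fin (n + 1), j < i → v i < v j := fun j hj => by
      obtain ⟨l, rfl⟩ := Fin.exists_succAbove_eq hj.ne
      have := h l
      rwa [laterSet, if_pos hj] at this
    have hle : ∀ j : Fin (n + 1), v i ≤ v j := fun j => by
      rcases eq_or_ne j i with rfl | hj
      · exact le_rfl
      · obtain ⟨l, rfl⟩ := Fin.exists_succAbove_eq hj
        have := h l
        unfold laterSet at this
        split_ifs at this
        · exact (Set.mem_Ioi.1 this).le
        · exact this
    refine ⟨Nat.lt_succ_iff.1 i.2, fun j hj => ?_, fun j hj => ?_⟩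
    · rw [padZero_val, padZero_of_lt v (Nat.lt_succ_of_le hj)]
      exact hle _
    · rw [padZero_val, padZero_of_lt v (hj.trans i.2)]
      exact hlt ⟨j, hj.trans i.2⟩ hj

section

variable {lam mu : ℝ}

/-- The mean of `F` over the states of the processor sharing queue at time `c` with `n` others, when
the time to the next arrival and the residual requirements are exponential. -/
noncomputable def psValue (lam mu : ℝ) (F : PSState ⊕ ℝ → ℝ≥0∞) (c : ℝ) (n : ℕ) : ℝ≥0∞ :=
  ∫⁻ u, ∫⁻ v : Fin (n + 1) → ℝ, F (Sum.inl ⟨c, u, n, padZero v⟩)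
    ∂(Measure.pi fun _ => expMeasure mu) ∂(expMeasure lam)

/-- The value of `F` after customer `i` has completed, when `w` is the requirement it had, `v` the
vector of what the others still have, and `u` the time to the next arrival. -/
noncomputable def afterCompletion (F : PSState ⊕ ℝ → ℝ≥0∞) (c : ℝ) {n : ℕ} (i : Fin (n + 1))
    (w : ℝ) (v : Fin n → ℝ) (u : ℝ) : ℝ≥0∞ :=
  if i = 0 then F (Sum.inr (c + (n + 1) * w))
  else F (Sum.inl ⟨c + (n + 1) * w, u, n - 1, padZero v⟩)

open Classical in
/-- The mean value of `F` after an arrival at time `c`, which is admitted with probability `β`, when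
`v` is the vector of residual requirements at that time. -/
noncomputable def afterArrival (lam mu : ℝ) (F : PSState ⊕ ℝ → ℝ≥0∞) (β c : ℝ) {n : ℕ}
    (v : Fin (n + 1) → ℝ) : ℝ≥0∞ :=
  ∫⁻ d : Draw, (if d.mark < β then
    F (Sum.inl ⟨c, d.gap, n + 1,
      padZero (Fin.insertNth (α := fun _ => ℝ) (Fin.last (n + 1)) d.work v)⟩)
    else F (Sum.inl ⟨c, d.gap, n, padZero v⟩)) ∂(drawLaw lam mu)

lemma measurable_psState_padZero {α : Type*} [MeasurableSpace α] {F : PSState ⊕ ℝ → ℝ≥0∞}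
    (hF : Measurable F) {c u : α → ℝ} {n m : ℕ} {v : α → Fin n → ℝ} (hc : Measurable c)
    (hu : Measurable u) (hv : Measurable v) :
    Measurable fun a => F (Sum.inl ⟨c a, u a, m, padZero (v a)⟩) :=
  hF.comp (measurable_inl.comp (PSState.measurable_mk hc hu measurable_const
    (measurable_padZero.comp hv)))

lemma measurable_afterCompletion {α : Type*} [MeasurableSpace α] {F : PSState ⊕ ℝ → ℝ≥0∞}
    (hF : Measurable F) (c : ℝ) {n : ℕ} (i : Fin (n + 1)) {w u : α → ℝ} {v : α → Fin n → ℝ}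
    (hw : Measurable w) (hv : Measurable v) (hu : Measurable u) :
    Measurable fun a => afterCompletion F c i (w a) (v a) (u a) := by
  unfold afterCompletion
  split_ifs
  · exact hF.comp (measurable_inr.comp (by fun_prop))
  · exact measurable_psState_padZero hF (by fun_prop) hu hv

lemma measurable_insertNth {α : Type*} [MeasurableSpace α] {n : ℕ} (i : Fin (n + 1)) {w : α → ℝ}
    {v : α → Fin n → ℝ} (hw : Measurable w) (hv : Measurable v) :
    Measurable fun a => Fin.insertNth (α := fun _ => ℝ) i (w a) (v a) := by
  refine measurable_pi_lambda _ fun j => ?_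
  rcases Fin.eq_self_or_eq_succAbove i j with rfl | ⟨l, rfl⟩
  · simpa using hw
  · simp only [Fin.insertNth_apply_succAbove]
    exact (measurable_pi_apply l).comp hv

lemma measurable_afterArrival (hlam : 0 < lam) (hmu : 0 < mu) {F : PSState ⊕ ℝ → ℝ≥0∞}
    (hF : Measurable F) (β : ℝ) {α : Type*} [MeasurableSpace α] {n : ℕ} {c : α → ℝ}
    {v : α → Fin (n + 1) → ℝ} (hc : Measurable c) (hv : Measurable v) :
    Measurable fun a => afterArrival lam mu F β (c a) (v a) := by
  classical
  have := isProbabilityMeasure_drawLaw hlam hmu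
  refine Measurable.lintegral_prod_right' (f := fun p : α × Draw => (if p.2.mark < β then
    F (Sum.inl ⟨c p.1, p.2.gap, n + 1,
      padZero (Fin.insertNth (α := fun _ => ℝ) (Fin.last (n + 1)) p.2.work (v p.1))⟩)
    else F (Sum.inl ⟨c p.1, p.2.gap, n, padZero (v p.1)⟩))) ?_
  exact Measurable.ite (measurableSet_lt (by fun_prop) measurable_const)
    (measurable_psState_padZero hF (by fun_prop) (by fun_prop)
      (measurable_insertNth _ (by fun_prop) (by fun_prop)))
    (measurable_psState_padZero hF (by fun_prop) (by fun_prop) (by fun_prop))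

open Classical in
/-- The effect of the first event, split into the case of an arrival, which comes first if every
requirement exceeds `u / (n + 1)`, and the cases that customer `i` completes first. At most one
term of the right-hand side is not `0`, as ties are broken in favour of the smaller number. -/
lemma transOp_psStep_eq (b : ℕ → ℝ) {F : PSState ⊕ ℝ → ℝ≥0∞} (hF : RespectsAgree F)
    (hlam : 0 < lam) (hmu : 0 < mu) (c u : ℝ) {n : ℕ} (v : Fin (n + 1) → ℝ) :
    transOp (drawLaw lam mu) (psStep b) F (Sum.inl ⟨c, u, n, padZero v⟩) =
      (if ∀ j, u / (n + 1) < v j then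
        afterArrival lam mu F (b (n + 1)) (c + u) (fun j => v j - u / (n + 1)) else 0) +
      ∑ i : Fin (n + 1), if (∀ j, v (i.succAbove j) ∈ laterSet i (v i) j) ∧ (n + 1) * v i ≤ u then
        afterCompletion F c i (v i) (fun j => v (i.succAbove j) - v i) (u - (n + 1) * v i)
        else 0 := by
  have := isProbabilityMeasure_drawLaw hlam hmu
  have hn : (0 : ℝ) < (n : ℝ) + 1 := by positivity
  set s : PSState := ⟨c, u, n, padZero v⟩ with hs
  have hmem := s.next_mem
  obtain ⟨I, hI⟩ : ∃ I : Fin (n + 1), (I : ℕ) = s.next := ⟨⟨s.next, Nat.lt_succ_of_le hmem.1⟩, rfl⟩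
  have hw : s.residual s.next = v I := by rw [← hI]; exact padZero_val v I
  have hmin : ∀ j, v I ≤ v j := fun j => by
    have := hmem.2 j (Nat.lt_succ_iff.1 j.2)
    rw [hw] at this
    simpa [hs] using this
  have huniq : ∀ i : Fin (n + 1), (∀ j, v (i.succAbove j) ∈ laterSet i (v i) j) ↔ i = I :=
      fun i => by
    rw [← next_eq_iff_mem_laterSet c u v i, ← hs, ← hI]
    exact ⟨fun h => (Fin.ext h).symm, fun h => by rw [h]⟩
  simp_rw [huniq]
  by_cases hcase : (n + 1) * v I ≤ u
  · have h1 : ¬ ∀ j, u / (n + 1) < v j := fun h => by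
      have := h I
      rw [div_lt_iff₀ hn, mul_comm] at this
      exact this.not_ge hcase
    rw [if_neg h1, zero_add, Finset.sum_eq_single I (fun i _ hi => if_neg fun h => hi h.1)
      (by simp),
      if_pos ⟨rfl, hcase⟩]
    have hstep : ∀ d, F (psStep b (Sum.inl s) d) =
        afterCompletion F c I (v I) (fun j => v (I.succAbove j) - v I) (u - (n + 1) * v I) := by
      intro d
      simp only [psStep, hw]
      rw [if_pos (by exact hcase), afterCompletion]
      by_cases h0 : I = 0
      · rw [if_pos h0, if_pos (by rw [← hI, h0]; rfl)]
      · rw [if_neg h0, if_neg (by rw [← hI]; exact fun h => h0 (Fin.ext h))]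
        refine hF _ _ ⟨rfl, rfl, rfl, fun j hj => ?_⟩
        have hI0 : (I : ℕ) ≠ 0 := fun h => h0 (Fin.ext h)
        have hIn := I.2
        have hj' : j < n := by
          have : j ≤ n - 1 := hj
          omega
        rw [← hI]
        simp only [hs]
        rw [padZero_of_lt _ hj']
        split_ifs with hlt
        · rw [padZero_of_lt v (by omega : j < n + 1), Fin.succAbove_of_castSucc_lt _ _ hlt]
          rfl
        · rw [padZero_of_lt v (by omega : j + 1 < n + 1),
            Fin.succAbove_of_le_castSucc _ _ (not_lt.1 hlt)]
          rfl
    rw [transOp, lintegral_congr hstep]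
    simp
  · have h1 : ∀ j, u / (n + 1) < v j := fun j => by
      rw [div_lt_iff₀ hn, mul_comm]
      exact (not_le.1 hcase).trans_le (mul_le_mul_of_nonneg_left (hmin j) hn.le)
    rw [if_pos h1, Finset.sum_eq_zero, add_zero]
    · refine lintegral_congr fun d => ?_
      simp only [psStep, hw]
      rw [if_neg (by exact hcase)]
      by_cases hm : d.mark < b (n + 1)
      · rw [if_pos (by exact hm), if_pos hm, ← update_padZero]
        refine hF _ _ ⟨rfl, rfl, rfl, fun j hj => ?_⟩
        have hj1 : j ≤ n + 1 := hj
        simp only [hs]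
        by_cases hj2 : j = n + 1
        · simp [hj2]
        · rw [Function.update_of_ne hj2, Function.update_of_ne hj2,
            padZero_of_lt v (by omega : j < n + 1), padZero_of_lt _ (by omega : j < n + 1)]
      · rw [if_neg (by exact hm), if_neg hm]
        refine hF _ _ ⟨rfl, rfl, rfl, fun j hj => ?_⟩
        have hj1 : j ≤ n := hj
        simp only [hs]
        rw [padZero_of_lt v (by omega : j < n + 1), padZero_of_lt _ (by omega : j < n + 1)]
    · intro i _
      exact if_neg (by rintro ⟨rfl, h⟩; exact hcase h)

/-- The service requirement of an admitted customer joins the i.i.d. vector as its last entry. -/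
lemma lintegral_afterArrival (hlam : 0 < lam) (hmu : 0 < mu) {F : PSState ⊕ ℝ → ℝ≥0∞}
    (hF : Measurable F) {β : ℝ} (hβ : β ∈ Set.Icc (0 : ℝ) 1) (c : ℝ) (n : ℕ) :
    ∫⁻ v : Fin (n + 1) → ℝ, afterArrival lam mu F β c v ∂(Measure.pi fun _ => expMeasure mu) =
      ENNReal.ofReal β * psValue lam mu F c (n + 1) +
        ENNReal.ofReal (1 - β) * psValue lam mu F c n := by
  classical
  have := isProbabilityMeasure_expMeasure hlam
  have := isProbabilityMeasure_expMeasure hmu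
  have := isProbabilityMeasure_drawLaw hlam hmu
  have hX : Measurable fun p : (Fin (n + 1) → ℝ) × ℝ × ℝ => F (Sum.inl ⟨c, p.2.1, n + 1,
      padZero (Fin.insertNth (α := fun _ => ℝ) (Fin.last (n + 1)) p.2.2 p.1)⟩) :=
    measurable_psState_padZero hF (by fun_prop) (by fun_prop)
      (measurable_insertNth _ (by fun_prop) (by fun_prop))
  have hY : Measurable fun p : (Fin (n + 1) → ℝ) × ℝ × ℝ =>
      F (Sum.inl ⟨c, p.2.1, n, padZero p.1⟩) :=
    measurable_psState_padZero hF (by fun_prop) (by fun_prop) (by fun_prop)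
  have h : ∀ v : Fin (n + 1) → ℝ, afterArrival lam mu F β c v =
      ENNReal.ofReal β * ∫⁻ g, ∫⁻ w, F (Sum.inl ⟨c, g, n + 1,
        padZero (Fin.insertNth (α := fun _ => ℝ) (Fin.last (n + 1)) w v)⟩)
          ∂(expMeasure mu) ∂(expMeasure lam) +
      ENNReal.ofReal (1 - β) * ∫⁻ g, F (Sum.inl ⟨c, g, n, padZero v⟩) ∂(expMeasure lam) := by
    intro v
    have := lintegral_drawLaw_mark hlam hmu hβ
      (X := fun g w => F (Sum.inl ⟨c, g, n + 1,
        padZero (Fin.insertNth (α := fun _ => ℝ) (Fin.last (n + 1)) w v)⟩))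
      (Y := fun g _ => F (Sum.inl ⟨c, g, n, padZero v⟩))
      (hX.comp measurable_prodMk_left) (hY.comp measurable_prodMk_left)
    simpa [afterArrival] using this
  have hX2 : Measurable fun p : (Fin (n + 1) → ℝ) × ℝ => ∫⁻ w, F (Sum.inl ⟨c, p.2, n + 1,
      padZero (Fin.insertNth (α := fun _ => ℝ) (Fin.last (n + 1)) w p.1)⟩) ∂(expMeasure mu) :=
    Measurable.lintegral_prod_right' (f := fun q : ((Fin (n + 1) → ℝ) × ℝ) × ℝ =>
      F (Sum.inl ⟨c, q.1.2, n + 1,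
        padZero (Fin.insertNth (α := fun _ => ℝ) (Fin.last (n + 1)) q.2 q.1.1)⟩))
      (hX.comp (by fun_prop :
        Measurable fun q : ((Fin (n + 1) → ℝ) × ℝ) × ℝ => (q.1.1, q.1.2, q.2)))
  have hY2 : Measurable fun p : (Fin (n + 1) → ℝ) × ℝ => F (Sum.inl ⟨c, p.2, n, padZero p.1⟩) :=
    hY.comp (by fun_prop : Measurable fun p : (Fin (n + 1) → ℝ) × ℝ => (p.1, p.2, (0 : ℝ)))
  simp_rw [h]
  rw [lintegral_add_left (hX2.lintegral_prod_right'.const_mul _),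
    lintegral_const_mul _ hX2.lintegral_prod_right',
    lintegral_const_mul _ hY2.lintegral_prod_right',
    lintegral_lintegral_swap (f := fun v g => ∫⁻ w, F (Sum.inl ⟨c, g, n + 1,
      padZero (Fin.insertNth (α := fun _ => ℝ) (Fin.last (n + 1)) w v)⟩) ∂(expMeasure mu))
      hX2.aemeasurable,
    lintegral_lintegral_swap (f := fun v g => F (Sum.inl ⟨c, g, n, padZero v⟩)) hY2.aemeasurable,
    psValue, psValue]
  congr 2
  refine lintegral_congr fun g => ?_
  have hg : Measurable fun p : (Fin (n + 1) → ℝ) × ℝ => F (Sum.inl ⟨c, g, n + 1,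
      padZero (Fin.insertNth (α := fun _ => ℝ) (Fin.last (n + 1)) p.2 p.1)⟩) :=
    hX.comp (by fun_prop : Measurable fun p : (Fin (n + 1) → ℝ) × ℝ => (p.1, g, p.2))
  rw [lintegral_lintegral_swap (f := fun v w => F (Sum.inl ⟨c, g, n + 1,
      padZero (Fin.insertNth (α := fun _ => ℝ) (Fin.last (n + 1)) w v)⟩)) hg.aemeasurable]
  exact (lintegral_pi_insertNth (expMeasure mu) (Fin.last (n + 1))
    (measurable_psState_padZero hF measurable_const measurable_const measurable_id)).symm

open Classical in
lemma measurable_completion {F : PSState ⊕ ℝ → ℝ≥0∞} (hF : Measurable F) (c : ℝ) {n : ℕ}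
    (i : Fin (n + 1)) :
    Measurable fun p : ℝ × (Fin (n + 1) → ℝ) =>
      if (∀ j, p.2 (i.succAbove j) ∈ laterSet i (p.2 i) j) ∧ (n + 1) * p.2 i ≤ p.1 then
        afterCompletion F c i (p.2 i) (fun j => p.2 (i.succAbove j) - p.2 i)
          (p.1 - (n + 1) * p.2 i) else 0 := by
  have hi : ∀ j, Measurable fun p : ℝ × (Fin (n + 1) → ℝ) => p.2 j := fun j => by fun_prop
  have hle : MeasurableSet {p : ℝ × (Fin (n + 1) → ℝ) | (n + 1) * p.2 i ≤ p.1} :=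
    measurableSet_le ((hi i).const_mul _) measurable_fst
  have hset : MeasurableSet
      {p : ℝ × (Fin (n + 1) → ℝ) | ∀ j, p.2 (i.succAbove j) ∈ laterSet i (p.2 i) j} := by
    rw [Set.ofPred_forall]
    refine MeasurableSet.iInter fun j => ?_
    unfold laterSet
    split_ifs
    · exact measurableSet_lt (hi _) (hi _)
    · exact measurableSet_le (hi _) (hi _)
  refine Measurable.ite (MeasurableSet.inter hset hle)
    (measurable_afterCompletion hF c i (by fun_prop) (by fun_prop) (by fun_prop)) measurable_const

open Classical in
/-- The contribution of the event that customer `i` is the next one to complete and does so before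
the next arrival. -/
lemma lintegral_completion (hlam : 0 < lam) (hmu : 0 < mu) {F : PSState ⊕ ℝ → ℝ≥0∞}
    (hF : Measurable F) (c : ℝ) {n : ℕ} (i : Fin (n + 1)) :
    ∫⁻ u, ∫⁻ v : Fin (n + 1) → ℝ,
      (if (∀ j, v (i.succAbove j) ∈ laterSet i (v i) j) ∧ (n + 1) * v i ≤ u then
        afterCompletion F c i (v i) (fun j => v (i.succAbove j) - v i) (u - (n + 1) * v i) else 0)
        ∂(Measure.pi fun _ => expMeasure mu) ∂(expMeasure lam) =
      ∫⁻ w, ENNReal.ofReal (Real.exp (-((n * mu) * w))) *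
        (ENNReal.ofReal (Real.exp (-(lam * ((n + 1) * w)))) *
          ∫⁻ u, ∫⁻ v, afterCompletion F c i w v u ∂(Measure.pi fun _ => expMeasure mu)
            ∂(expMeasure lam)) ∂(expMeasure mu) := by
  have := isProbabilityMeasure_expMeasure hlam
  have := isProbabilityMeasure_expMeasure hmu
  let K : ℝ → (Fin (n + 1) → ℝ) → ℝ≥0∞ := fun u v =>
    if (∀ j, v (i.succAbove j) ∈ laterSet i (v i) j) ∧ (n + 1) * v i ≤ u then
        afterCompletion F c i (v i) (fun j => v (i.succAbove j) - v i) (u - (n + 1) * v i) else 0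
  have hK : Measurable (Function.uncurry K) := measurable_completion hF c i
  change ∫⁻ u, ∫⁻ v, K u v ∂_ ∂_ = _
  rw [lintegral_lintegral_swap hK.aemeasurable, lintegral_pi_insertNth (expMeasure mu) i
    (Measurable.lintegral_prod_left' (f := fun p : ℝ × (Fin (n + 1) → ℝ) => K p.1 p.2) hK)]
  refine lintegral_congr_ae ?_
  filter_upwards [ae_nonneg_expMeasure mu] with w hw
  have hH : Measurable fun p : (Fin n → ℝ) × ℝ => afterCompletion F c i w p.1 p.2 :=
    measurable_afterCompletion hF c i measurable_const measurable_fst measurable_snd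
  have hbox : MeasurableSet (Set.pi Set.univ (laterSet i w)) := by
    refine MeasurableSet.univ_pi fun j => ?_
    rcases laterSet_eq i w j with h | h <;> rw [h]
    exacts [measurableSet_Ici, measurableSet_Ioi]
  have hinner : ∀ v : Fin n → ℝ,
      ∫⁻ u, K u (Fin.insertNth (α := fun _ => ℝ) i w v) ∂(expMeasure lam) =
      (Set.pi Set.univ (laterSet i w)).indicator (fun v =>
        ENNReal.ofReal (Real.exp (-(lam * ((n + 1) * w)))) *
          ∫⁻ u, afterCompletion F c i w (fun j => v j - w) u ∂(expMeasure lam)) v := by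
    intro v
    simp only [K, Fin.insertNth_apply_same, Fin.insertNth_apply_succAbove]
    by_cases hv : v ∈ Set.pi Set.univ (laterSet i w)
    · have hHv : Measurable fun u => afterCompletion F c i w (fun j => v j - w) u :=
        hH.comp measurable_prodMk_left
      rw [Set.indicator_of_mem hv, ← setLIntegral_sub_expMeasure lam (by positivity) (Or.inl rfl)
        hHv, ← lintegral_indicator measurableSet_Ici]
      refine lintegral_congr fun u => ?_
      have hv' : ∀ j, v j ∈ laterSet i w j := fun j => hv j trivial
      simp [Set.indicator_apply, hv']
    · have hv' : ¬ ∀ j, v j ∈ laterSet i w j := fun h => hv fun j _ => h j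
      simp [hv, hv']
  simp_rw [hinner]
  rw [lintegral_indicator hbox, setLIntegral_pi_sub_expMeasure hmu hw n (laterSet_eq i w)
    (f := fun v => ENNReal.ofReal (Real.exp (-(lam * ((n + 1) * w)))) *
      ∫⁻ u, afterCompletion F c i w v u ∂(expMeasure lam)) (hH.lintegral_prod_right'.const_mul _),
    lintegral_const_mul _ hH.lintegral_prod_right', mul_assoc (n : ℝ),
    lintegral_lintegral_swap (f := fun v u => afterCompletion F c i w v u) hH.aemeasurable]

lemma measurable_psValue (hlam : 0 < lam) (hmu : 0 < mu) {F : PSState ⊕ ℝ → ℝ≥0∞}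
    (hF : Measurable F) (n : ℕ) : Measurable fun c => psValue lam mu F c n := by
  have := isProbabilityMeasure_expMeasure hlam
  have := isProbabilityMeasure_expMeasure hmu
  refine Measurable.lintegral_prod_right' (f := fun p : ℝ × ℝ =>
    ∫⁻ v : Fin (n + 1) → ℝ, F (Sum.inl ⟨p.1, p.2, n, padZero v⟩)
      ∂(Measure.pi fun _ => expMeasure mu)) ?_
  exact Measurable.lintegral_prod_right' (f := fun q : (ℝ × ℝ) × (Fin (n + 1) → ℝ) =>
    F (Sum.inl ⟨q.1.1, q.1.2, n, padZero q.2⟩))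
    (measurable_psState_padZero hF (by fun_prop) (by fun_prop) (by fun_prop))

lemma lintegral_afterCompletion (hlam : 0 < lam) (hmu : 0 < mu) (F : PSState ⊕ ℝ → ℝ≥0∞)
    (c : ℝ) {n : ℕ} (i : Fin (n + 1)) (w : ℝ) :
    ∫⁻ u, ∫⁻ v, afterCompletion F c i w v u ∂(Measure.pi fun _ => expMeasure mu)
      ∂(expMeasure lam) =
      if i = 0 then F (Sum.inr (c + (n + 1) * w))
      else psValue lam mu F (c + (n + 1) * w) (n - 1) := by
  have := isProbabilityMeasure_expMeasure hlam
  have := isProbabilityMeasure_expMeasure hmu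
  unfold afterCompletion
  split_ifs with hi
  · simp
  · cases n with
    | zero => exact absurd (Fin.fin_one_eq_zero i) hi
    | succ m => rfl

lemma lintegral_lintegral_add_sum {α β ι : Type*} [MeasurableSpace α] [MeasurableSpace β]
    [Fintype ι] {μ : Measure α} {ν : Measure β} [SFinite ν] {U : α → β → ℝ≥0∞}
    {T : ι → α → β → ℝ≥0∞} (hU : Measurable (Function.uncurry U))
    (hT : ∀ i, Measurable (Function.uncurry (T i))) :
    ∫⁻ u, ∫⁻ v, (U u v + ∑ i, T i u v) ∂ν ∂μ =
      ∑ i, ∫⁻ u, ∫⁻ v, T i u v ∂ν ∂μ + ∫⁻ u, ∫⁻ v, U u v ∂ν ∂μ := by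
  have h : ∀ u, ∫⁻ v, (U u v + ∑ i, T i u v) ∂ν = ∫⁻ v, U u v ∂ν + ∑ i, ∫⁻ v, T i u v ∂ν :=
    fun u => by
      rw [lintegral_add_left hU.of_uncurry_left,
        lintegral_finsetSum _ fun i _ => (hT i).of_uncurry_left]
  simp_rw [h]
  rw [lintegral_add_left hU.lintegral_prod_right,
    lintegral_finsetSum _ fun i _ => (hT i).lintegral_prod_right, add_comm]

/-- The mean of `F` after one more event of the processor sharing queue. -/
lemma psValue_transOp (hlam : 0 < lam) (hmu : 0 < mu) {b : ℕ → ℝ} {n : ℕ}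
    (hb : b (n + 1) ∈ Set.Icc (0 : ℝ) 1) {F : PSState ⊕ ℝ → ℝ≥0∞} (hF : Measurable F)
    (hFa : RespectsAgree F) (c : ℝ) :
    psValue lam mu (transOp (drawLaw lam mu) (psStep b) F) c n =
      eventValue lam mu (b (n + 1)) n (fun τ => F (Sum.inr τ)) (psValue lam mu F) c := by
  classical
  have := isProbabilityMeasure_expMeasure hlam
  have := isProbabilityMeasure_expMeasure hmu
  have hn : (0 : ℝ) < (n : ℝ) + 1 := by positivity
  have hterm := fun i : Fin (n + 1) => measurable_completion hF c i
  have harr : Measurable fun p : ℝ × (Fin (n + 1) → ℝ) =>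
      if ∀ j, p.1 / (n + 1) < p.2 j then
        afterArrival lam mu F (b (n + 1)) (c + p.1) (fun j => p.2 j - p.1 / (n + 1)) else 0 := by
    have hset : MeasurableSet {p : ℝ × (Fin (n + 1) → ℝ) | ∀ j, p.1 / (n + 1) < p.2 j} := by
      rw [Set.ofPred_forall]
      exact MeasurableSet.iInter fun j => measurableSet_lt (by fun_prop) (by fun_prop)
    exact Measurable.ite hset
      (measurable_afterArrival hlam hmu hF _ (by fun_prop) (by fun_prop)) measurable_const
  -- splitting according to the kind of the first event
  have hsplit : psValue lam mu (transOp (drawLaw lam mu) (psStep b) F) c n =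
      ∑ i : Fin (n + 1), (∫⁻ u, ∫⁻ v : Fin (n + 1) → ℝ,
        (if (∀ j, v (i.succAbove j) ∈ laterSet i (v i) j) ∧ (n + 1) * v i ≤ u then
        afterCompletion F c i (v i) (fun j => v (i.succAbove j) - v i) (u - (n + 1) * v i) else 0)
        ∂(Measure.pi fun _ => expMeasure mu) ∂(expMeasure lam)) +
      ∫⁻ u, ∫⁻ v : Fin (n + 1) → ℝ, (if ∀ j, u / (n + 1) < v j then
        afterArrival lam mu F (b (n + 1)) (c + u) (fun j => v j - u / (n + 1)) else 0)
        ∂(Measure.pi fun _ => expMeasure mu) ∂(expMeasure lam) := by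
    unfold psValue
    simp_rw [transOp_psStep_eq b hFa hlam hmu]
    exact lintegral_lintegral_add_sum
      (U := fun (u : ℝ) (v : Fin (n + 1) → ℝ) => if ∀ j, u / (n + 1) < v j then
        afterArrival lam mu F (b (n + 1)) (c + u) (fun j => v j - u / (n + 1)) else 0)
      (T := fun i (u : ℝ) (v : Fin (n + 1) → ℝ) =>
        if (∀ j, v (i.succAbove j) ∈ laterSet i (v i) j) ∧ (n + 1) * v i ≤ u then
        afterCompletion F c i (v i) (fun j => v (i.succAbove j) - v i) (u - (n + 1) * v i) else 0)
      harr hterm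
  have hFr : Measurable fun y : ℝ => F (Sum.inr (c + y)) :=
    hF.comp (measurable_inr.comp (by fun_prop))
  have hV : Measurable fun y : ℝ => psValue lam mu F (c + y) (n - 1) :=
    (measurable_psValue hlam hmu hF (n - 1)).comp (by fun_prop)
  have hE : Measurable fun y : ℝ => ENNReal.ofReal (Real.exp (-(lam * y))) := by fun_prop
  -- the least of the `n + 1` exponential times, run at speed `1 / (n + 1)`, has the original rate
  have hscale : ∀ f : ℝ → ℝ≥0∞, Measurable f →
      ∫⁻ w, ENNReal.ofReal (Real.exp (-((n * mu) * w))) * f ((n + 1) * w) ∂(expMeasure mu) =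
        ENNReal.ofReal (1 / ((n : ℝ) + 1)) * ∫⁻ y, f y ∂(expMeasure mu) := fun f hf => by
    rw [← lintegral_expMeasure_comp_mul hmu hn (s := n * mu) (by ring) hf, ← mul_assoc,
      ← ENNReal.ofReal_mul (by positivity), one_div, inv_mul_cancel₀ hn.ne', ENNReal.ofReal_one,
      one_mul]
  have hcard : (n : ℝ≥0∞) * ENNReal.ofReal (1 / ((n : ℝ) + 1)) =
      ENNReal.ofReal (1 - 1 / ((n : ℝ) + 1)) := by
    rw [← ENNReal.ofReal_natCast, ← ENNReal.ofReal_mul (by positivity)]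
    congr 1
    field_simp
    ring
  rw [hsplit, eventValue]
  congr 1
  · simp_rw [lintegral_completion hlam hmu hF, lintegral_afterCompletion hlam hmu F]
    rw [Fin.sum_univ_succ]
    simp only [if_true, Fin.succ_ne_zero, if_false, Finset.sum_const, Finset.card_univ,
      Fintype.card_fin, nsmul_eq_mul]
    have hEF : Measurable fun y : ℝ =>
        ENNReal.ofReal (Real.exp (-(lam * y))) * F (Sum.inr (c + y)) := hE.mul hFr
    have hEV : Measurable fun y : ℝ =>
        ENNReal.ofReal (Real.exp (-(lam * y))) * psValue lam mu F (c + y) (n - 1) := hE.mul hV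
    rw [hscale _ hEF, hscale _ hEV, ← mul_assoc, hcard, ← lintegral_const_mul _ hEF,
      ← lintegral_const_mul _ hEV, ← lintegral_add_left (hEF.const_mul _)]
    refine lintegral_congr fun y => ?_
    ring
  · refine lintegral_congr_ae ?_
    filter_upwards [ae_nonneg_expMeasure lam] with u hu
    have hbox : MeasurableSet (Set.pi Set.univ fun _ : Fin (n + 1) => Set.Ioi (u / (n + 1))) :=
      MeasurableSet.univ_pi fun _ => measurableSet_Ioi
    have h := setLIntegral_pi_sub_expMeasure hmu (by positivity : 0 ≤ u / (n + 1)) (n + 1)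
      (fun _ => Or.inr rfl) (measurable_afterArrival hlam hmu hF (b (n + 1))
        (measurable_const : Measurable fun _ => c + u) measurable_id)
    rw [← lintegral_indicator hbox] at h
    simp only [id] at h
    rw [lintegral_afterArrival hlam hmu hF hb] at h
    have hexp : ((n + 1 : ℕ) : ℝ) * (mu * (u / (n + 1))) = mu * u := by
      push_cast
      field_simp
    rw [hexp] at h
    rw [← h]
    refine lintegral_congr fun v => ?_
    simp [Set.indicator_apply]

end

/-! ### Equality in law -/

section

variable {lam mu : ℝ}

/-- The time at which the tagged customer has left, or started its service; `⊤` if it has not. -/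
noncomputable def leavingTime {S : Type*} : S ⊕ ℝ → ℝ≥0∞ := Sum.elim (fun _ => ⊤) ENNReal.ofReal

lemma measurable_leavingTime {S : Type*} [MeasurableSpace S] :
    Measurable (leavingTime (S := S)) :=
  measurable_const.sumElim ENNReal.measurable_ofReal

lemma iterate_transOp_inr {S X : Type*} [MeasurableSpace X] {P : Measure X}
    [IsProbabilityMeasure P] {step : S ⊕ ℝ → X → S ⊕ ℝ}
    (h : ∀ τ d, step (Sum.inr τ) d = Sum.inr τ) (F : S ⊕ ℝ → ℝ≥0∞) (k : ℕ) (τ : ℝ) :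
    (transOp P step)^[k] F (Sum.inr τ) = F (Sum.inr τ) := by
  induction k with
  | zero => rfl
  | succ k ih => rw [Function.iterate_succ_apply', transOp]; simp [h, ih]

lemma respectsAgree_iterate {F : PSState ⊕ ℝ → ℝ≥0∞} (hF : RespectsAgree F) (P : Measure Draw)
    (b : ℕ → ℝ) (k : ℕ) : RespectsAgree ((transOp P (psStep b))^[k] F) := by
  induction k with
  | zero => exact hF
  | succ k ih =>
    rw [Function.iterate_succ_apply']
    exact ih.transOp P b

/-- Both queues satisfy the recursion `eventValue`, so their mean values agree after `k` events. -/
lemma psValue_iterate_eq_rosValue_iterate (hlam : 0 < lam) (hmu : 0 < mu) {b br : ℕ → ℝ}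
    (hb : ∀ n, b n ∈ Set.Icc (0 : ℝ) 1) (hbr : ∀ n, br (n + 1) = b n) {g : ℝ≥0∞ → ℝ≥0∞}
    (hg : Measurable g) (k : ℕ) (c : ℝ) (n : ℕ) :
    psValue lam mu ((transOp (drawLaw lam mu) (psStep b))^[k] (g ∘ leavingTime)) c n =
      rosValue lam mu ((transOp (drawLaw lam mu) (rosStep br))^[k] (g ∘ leavingTime)) c n := by
  have := isProbabilityMeasure_expMeasure hlam
  have := isProbabilityMeasure_expMeasure hmu
  have := isProbabilityMeasure_drawLaw hlam hmu
  induction k generalizing c n with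
  | zero => simp [psValue, rosValue, leavingTime]
  | succ k ih =>
    have hbr' : br (n + 2) = b (n + 1) := hbr (n + 1)
    rw [Function.iterate_succ_apply', Function.iterate_succ_apply',
      psValue_transOp hlam hmu (hb (n + 1))
        (measurable_iterate_transOp (measurable_psStep b) (hg.comp measurable_leavingTime) k)
        (respectsAgree_iterate (fun _ _ _ => rfl) _ b k),
      rosValue_transOp hlam hmu (hbr' ▸ hb (n + 1))
        (measurable_iterate_transOp (measurable_rosStep br) (hg.comp measurable_leavingTime) k),
      hbr']
    congr 1
    · funext τ
      rw [iterate_transOp_inr fun _ _ => rfl, iterate_transOp_inr fun _ _ => rfl]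
      rfl
    · funext c n
      exact ih c n

lemma psRun_eq_runFrom (b : ℕ → ℝ) (n : ℕ) (ω : Sample) (k : ℕ) :
    psRun b n ω k = runFrom (psStep b) (Sum.inl ⟨0, ω.1, n, ω.2.1⟩) ω.2.2 k := by
  induction k with
  | zero => rfl
  | succ k ih => rw [psRun, ih, runFrom]

lemma rosRun_eq_runFrom (br : ℕ → ℝ) (n : ℕ) (ω : Sample) (k : ℕ) :
    rosRun br n ω k = runFrom (rosStep br) (Sum.inl ⟨0, ω.1, n, ω.2.1 0⟩) ω.2.2 k := by
  induction k with
  | zero => rfl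
  | succ k ih => rw [rosRun, ih, runFrom]

lemma measurable_psRun (b : ℕ → ℝ) (n k : ℕ) : Measurable fun ω => psRun b n ω k := by
  simp_rw [psRun_eq_runFrom]
  exact (measurable_runFrom (measurable_psStep b) k).comp
    ((measurable_inl.comp (PSState.measurable_mk measurable_const measurable_fst measurable_const
      measurable_snd.fst)).prodMk measurable_snd.snd)

lemma measurable_rosRun (br : ℕ → ℝ) (n k : ℕ) : Measurable fun ω => rosRun br n ω k := by
  simp_rw [rosRun_eq_runFrom]
  exact (measurable_runFrom (measurable_rosStep br) k).comp
    ((measurable_inl.comp (ROSState.measurable_mk measurable_const measurable_fst measurable_const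
      ((measurable_pi_apply 0).comp measurable_snd.fst))).prodMk measurable_snd.snd)

lemma measurable_psSojourn (b : ℕ → ℝ) (n : ℕ) : Measurable (psSojourn b n) :=
  Measurable.iInf fun k => measurable_leavingTime.comp (measurable_psRun b n k)

lemma measurable_rosWait (br : ℕ → ℝ) (n : ℕ) : Measurable (rosWait br n) :=
  Measurable.iInf fun k => measurable_leavingTime.comp (measurable_rosRun br n k)

lemma lintegral_sampleLaw (hlam : 0 < lam) (hmu : 0 < mu) {G : Sample → ℝ≥0∞} (hG : Measurable G) :
    ∫⁻ ω, G ω ∂(sampleLaw lam mu) =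
      ∫⁻ u, ∫⁻ r, ∫⁻ D, G (u, r, D) ∂(Measure.infinitePi fun _ : ℕ => drawLaw lam mu)
        ∂(Measure.infinitePi fun _ : ℕ => expMeasure mu) ∂(expMeasure lam) := by
  have := isProbabilityMeasure_expMeasure hlam
  have := isProbabilityMeasure_expMeasure hmu
  have := isProbabilityMeasure_drawLaw hlam hmu
  rw [sampleLaw, lintegral_prod _ hG.aemeasurable]
  exact lintegral_congr fun u => lintegral_prod _ (hG.comp measurable_prodMk_left).aemeasurable

lemma lintegral_leavingTime_psRun (hlam : 0 < lam) (hmu : 0 < mu) (b : ℕ → ℝ) {g : ℝ≥0∞ → ℝ≥0∞}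
    (hg : Measurable g) (n k : ℕ) :
    ∫⁻ ω, g (leavingTime (psRun b n ω k)) ∂(sampleLaw lam mu) =
      psValue lam mu ((transOp (drawLaw lam mu) (psStep b))^[k] (g ∘ leavingTime)) 0 n := by
  have := isProbabilityMeasure_expMeasure hlam
  have := isProbabilityMeasure_expMeasure hmu
  have := isProbabilityMeasure_drawLaw hlam hmu
  have hF := hg.comp (measurable_leavingTime (S := PSState))
  have hG : Measurable fun ω => g (leavingTime (psRun b n ω k)) :=
    hg.comp (measurable_leavingTime.comp (measurable_psRun b n k))
  rw [lintegral_sampleLaw hlam hmu hG]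
  refine lintegral_congr fun u => ?_
  have hm : Measurable fun v : Fin (n + 1) → ℝ => (transOp (drawLaw lam mu) (psStep b))^[k]
      (g ∘ leavingTime) (Sum.inl ⟨0, u, n, padZero v⟩) :=
    measurable_psState_padZero (measurable_iterate_transOp (measurable_psStep b) hF k)
      measurable_const measurable_const measurable_id
  rw [← lintegral_infinitePi_fin _ _ hm]
  refine lintegral_congr fun r => ?_
  simp_rw [psRun_eq_runFrom]
  refine (lintegral_runFrom (measurable_psStep b) hF k _).trans ?_
  refine respectsAgree_iterate (fun _ _ _ => rfl) _ b k _ _ ⟨rfl, rfl, rfl, fun j hj => ?_⟩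
  exact (padZero_of_lt (fun i : Fin (n + 1) => r i) (Nat.lt_succ_of_le hj)).symm

lemma lintegral_leavingTime_rosRun (hlam : 0 < lam) (hmu : 0 < mu) (br : ℕ → ℝ) {g : ℝ≥0∞ → ℝ≥0∞}
    (hg : Measurable g) (n k : ℕ) :
    ∫⁻ ω, g (leavingTime (rosRun br n ω k)) ∂(sampleLaw lam mu) =
      rosValue lam mu ((transOp (drawLaw lam mu) (rosStep br))^[k] (g ∘ leavingTime)) 0 n := by
  have := isProbabilityMeasure_expMeasure hlam
  have := isProbabilityMeasure_expMeasure hmu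
  have := isProbabilityMeasure_drawLaw hlam hmu
  have hF := hg.comp (measurable_leavingTime (S := ROSState))
  have hG : Measurable fun ω => g (leavingTime (rosRun br n ω k)) :=
    hg.comp (measurable_leavingTime.comp (measurable_rosRun br n k))
  rw [lintegral_sampleLaw hlam hmu hG]
  refine lintegral_congr fun u => ?_
  have hm : Measurable fun s : ℝ => (transOp (drawLaw lam mu) (rosStep br))^[k]
      (g ∘ leavingTime) (Sum.inl ⟨0, u, n, s⟩) :=
    (measurable_iterate_transOp (measurable_rosStep br) hF k).comp (measurable_inl.comp
      (ROSState.measurable_mk measurable_const measurable_const measurable_const measurable_id))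
  rw [← (measurePreserving_eval_infinitePi (fun _ : ℕ => expMeasure mu) 0).lintegral_comp hm]
  refine lintegral_congr fun r => ?_
  simp_rw [rosRun_eq_runFrom]
  exact lintegral_runFrom (measurable_rosStep br) hF k _

lemma antitone_leavingTime {S X : Type*} {step : S ⊕ ℝ → X → S ⊕ ℝ}
    (h : ∀ τ d, step (Sum.inr τ) d = Sum.inr τ) (s : S ⊕ ℝ) (D : ℕ → X) :
    Antitone fun k => leavingTime (runFrom step s D k) := by
  refine antitone_nat_of_succ_le fun k => ?_
  rw [runFrom]
  cases runFrom step s D k with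
  | inl s => exact le_top
  | inr τ => rw [h]

/-- Equality in law of the terms of two antitone sequences passes to their infima. -/
lemma map_iInf_eq {Ω : Type*} [MeasurableSpace Ω] {P : Measure Ω} [IsFiniteMeasure P]
    {X Y : ℕ → Ω → ℝ≥0∞} (hX : ∀ k, Measurable (X k)) (hY : ∀ k, Measurable (Y k))
    (hXa : ∀ ω, Antitone fun k => X k ω) (hYa : ∀ ω, Antitone fun k => Y k ω)
    (h : ∀ k, P.map (X k) = P.map (Y k)) :
    P.map (fun ω => ⨅ k, X k ω) = P.map (fun ω => ⨅ k, Y k ω) := by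
  have key : ∀ Z : ℕ → Ω → ℝ≥0∞, (∀ k, Measurable (Z k)) → (∀ ω, Antitone fun k => Z k ω) →
      ∀ a, P.map (fun ω => ⨅ k, Z k ω) (Set.Ici a) = ⨅ k, P.map (Z k) (Set.Ici a) := by
    intro Z hZ hZa a
    rw [Measure.map_apply (Measurable.iInf hZ) measurableSet_Ici]
    simp_rw [Measure.map_apply (hZ _) measurableSet_Ici]
    rw [← Antitone.measure_iInter]
    · congr 1
      ext ω
      simp
    · exact fun i j hij ω hω => le_trans hω (hZa ω hij)
    · exact fun k => (hZ k measurableSet_Ici).nullMeasurableSet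
    · exact ⟨0, measure_ne_top _ _⟩
  refine Measure.ext_of_Ici _ _ fun a => ?_
  rw [key X hX hXa, key Y hY hYa]
  simp_rw [h]

theorem identDistrib_psSojourn_rosWait (hlam : 0 < lam) (hmu : 0 < mu) {b br : ℕ → ℝ}
    (hb : ∀ n, b n ∈ Set.Icc (0 : ℝ) 1) (hbr : ∀ n, br (n + 1) = b n) (n : ℕ) :
    IdentDistrib (psSojourn b n) (rosWait br n) (sampleLaw lam mu) (sampleLaw lam mu) := by
  have := isProbabilityMeasure_sampleLaw hlam hmu
  refine ⟨(measurable_psSojourn b n).aemeasurable, (measurable_rosWait br n).aemeasurable, ?_⟩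
  have hX := fun k => measurable_leavingTime.comp (measurable_psRun b n k)
  have hY := fun k => measurable_leavingTime.comp (measurable_rosRun br n k)
  refine map_iInf_eq hX hY (fun ω => ?_) (fun ω => ?_) fun k => ?_
  · simp only [psRun_eq_runFrom]
    exact antitone_leavingTime (fun _ _ => rfl) _ _
  · simp only [rosRun_eq_runFrom]
    exact antitone_leavingTime (fun _ _ => rfl) _ _
  · refine Measure.ext_of_lintegral _ fun g hg => ?_
    refine (lintegral_map hg (hX k)).trans (Eq.trans ?_ (lintegral_map hg (hY k)).symm)
    exact (lintegral_leavingTime_psRun hlam hmu b hg n k).trans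
      ((psValue_iterate_eq_rosValue_iterate hlam hmu hb hbr hg k 0 n).trans
        (lintegral_leavingTime_rosRun hlam hmu br hg n k).symm)

end

/-! ### Steady state -/

section

variable {lam mu : ℝ}

lemma IsSteadyState.detailed_balance {b : ℕ → ℝ} {π : PMF ℕ} (h : IsSteadyState lam mu b π)
    (n : ℕ) : lam * b n * (π n).toReal = mu * (π (n + 1)).toReal := by
  induction n with
  | zero => exact h.balance_zero
  | succ n ih => linarith [h.balance_succ n]

lemma IsSteadyState.eq_pow_mul_prod (hmu : 0 < mu) {b : ℕ → ℝ} {π : PMF ℕ}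
    (h : IsSteadyState lam mu b π) (n : ℕ) :
    (π n).toReal = (lam / mu) ^ n * (∏ i ∈ Finset.range n, b i) * (π 0).toReal := by
  induction n with
  | zero => simp
  | succ n ih =>
    have h1 : (π (n + 1)).toReal = lam / mu * b n * (π n).toReal := by
      have := h.detailed_balance n
      field_simp
      linarith
    rw [h1, ih, Finset.prod_range_succ, pow_succ]
    ring

lemma summable_pmf_toReal (π : PMF ℕ) : Summable fun n => (π n).toReal :=
  ENNReal.summable_toReal (by rw [π.tsum_coe]; exact ENNReal.one_ne_top)

lemma IsSteadyState.zero_ne (hmu : 0 < mu) {b : ℕ → ℝ} {π : PMF ℕ}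
    (h : IsSteadyState lam mu b π) : (π 0).toReal ≠ 0 := by
  intro h0
  have hz : ∀ n, π n = 0 := fun n => by
    have := h.eq_pow_mul_prod hmu n
    rw [h0, mul_zero, ENNReal.toReal_eq_zero_iff] at this
    exact this.resolve_right (π.apply_ne_top n)
  have := π.tsum_coe
  simp [hz] at this

lemma IsSteadyState.summable (hmu : 0 < mu) {b : ℕ → ℝ} {π : PMF ℕ}
    (h : IsSteadyState lam mu b π) :
    Summable fun n => (lam / mu) ^ n * ∏ i ∈ Finset.range n, b i := by
  refine ((summable_pmf_toReal π).mul_right (π 0).toReal⁻¹).congr fun n => ?_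
  rw [h.eq_pow_mul_prod hmu n, mul_assoc, mul_inv_cancel₀ (h.zero_ne hmu), mul_one]

lemma measurableSet_joins_inter {b : ℕ → ℝ} {S : ℕ → Set Sample} (hS : ∀ n, MeasurableSet (S n)) :
    MeasurableSet {x : ℕ × ℝ × Sample | x.2.1 < b x.1 ∧ x.2.2 ∈ S x.1} := by
  have : {x : ℕ × ℝ × Sample | x.2.1 < b x.1 ∧ x.2.2 ∈ S x.1} =
      ⋃ n, {n} ×ˢ (Set.Iio (b n) ×ˢ S n) := by
    ext ⟨n, m, ω⟩
    simp
  rw [this]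
  exact MeasurableSet.iUnion fun n =>
    (measurableSet_singleton n).prod (measurableSet_Iio.prod (hS n))

lemma arrivalLaw_real_joins_inter (hlam : 0 < lam) (hmu : 0 < mu) (π : PMF ℕ) {b : ℕ → ℝ}
    (hb : ∀ n, b n ∈ Set.Icc (0 : ℝ) 1) {S : ℕ → Set Sample} (hS : ∀ n, MeasurableSet (S n)) :
    (arrivalLaw lam mu π).real {x | x.2.1 < b x.1 ∧ x.2.2 ∈ S x.1} =
      ∑' n, (π n).toReal * b n * (sampleLaw lam mu).real (S n) := by
  have := isProbabilityMeasure_sampleLaw hlam hmu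
  have h : arrivalLaw lam mu π {x | x.2.1 < b x.1 ∧ x.2.2 ∈ S x.1} =
      ∑' n, ENNReal.ofReal (b n) * sampleLaw lam mu (S n) * π n := by
    rw [arrivalLaw, Measure.prod_apply (measurableSet_joins_inter hS), lintegral_countable']
    refine tsum_congr fun n => ?_
    rw [PMF.toMeasure_apply_singleton _ _ (measurableSet_singleton n), ← uniform01_Iio (hb n),
      ← Measure.prod_prod]
    rfl
  rw [measureReal_def, h, ENNReal.tsum_toReal_eq fun n => ENNReal.mul_ne_top
    (ENNReal.mul_ne_top ENNReal.ofReal_ne_top (measure_ne_top _ _)) (π.apply_ne_top n)]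
  refine tsum_congr fun n => ?_
  rw [ENNReal.toReal_mul, ENNReal.toReal_mul, ENNReal.toReal_ofReal (hb n).1, measureReal_def]
  ring

/-- Conditioning on joining weights the number found by `b`. -/
lemma cond_joins_real (hlam : 0 < lam) (hmu : 0 < mu) (π : PMF ℕ) {b : ℕ → ℝ}
    (hb : ∀ n, b n ∈ Set.Icc (0 : ℝ) 1) {S : ℕ → Set Sample} (hS : ∀ n, MeasurableSet (S n)) :
    (cond (arrivalLaw lam mu π) (joins b)).real {x | x.2.2 ∈ S x.1} =
      (∑' n, (π n).toReal * b n * (sampleLaw lam mu).real (S n)) / ∑' n, (π n).toReal * b n := by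
  have := isProbabilityMeasure_sampleLaw hlam hmu
  have huniv := measurableSet_joins_inter (b := b) fun _ => MeasurableSet.univ
  have h1 := arrivalLaw_real_joins_inter hlam hmu π hb fun _ => MeasurableSet.univ
  simp only [Set.mem_univ, and_true, probReal_univ, mul_one] at h1 huniv
  rw [measureReal_def, joins, cond_apply huniv, ENNReal.toReal_mul, ENNReal.toReal_inv,
    ← measureReal_def, ← measureReal_def, h1, ← arrivalLaw_real_joins_inter hlam hmu π hb hS,
    div_eq_inv_mul]
  rfl

/-- In a stationary queue the number found by a joining customer has weights
`ρ ^ n * b 0 * ⋯ * b n`. -/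
lemma IsSteadyState.cond_joins_real (hlam : 0 < lam) (hmu : 0 < mu) {π : PMF ℕ} {b : ℕ → ℝ}
    (h : IsSteadyState lam mu b π) (hb : ∀ n, b n ∈ Set.Icc (0 : ℝ) 1) {S : ℕ → Set Sample}
    (hS : ∀ n, MeasurableSet (S n)) :
    (cond (arrivalLaw lam mu π) (joins b)).real {x | x.2.2 ∈ S x.1} =
      (∑' n, (lam / mu) ^ n * (∏ i ∈ Finset.range (n + 1), b i) * (sampleLaw lam mu).real (S n)) /
        ∑' n, (lam / mu) ^ n * ∏ i ∈ Finset.range (n + 1), b i := by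
  have h1 : ∀ n, (π n).toReal * b n =
      (π 0).toReal * ((lam / mu) ^ n * ∏ i ∈ Finset.range (n + 1), b i) := fun n => by
    rw [h.eq_pow_mul_prod hmu n, Finset.prod_range_succ]
    ring
  rw [_root_.cond_joins_real hlam hmu π hb hS]
  simp_rw [h1, mul_assoc (π 0).toReal]
  rw [tsum_mul_left, tsum_mul_left, mul_div_mul_left _ _ (h.zero_ne hmu)]

/-- The two series of `equivConst` are the exponential series without its first one or two terms. -/
lemma equivConst_one_div (ρ : ℝ) (hρ : 0 < ρ) {b : ℕ → ℝ} (hb : ∀ n : ℕ, b n = 1 / ((n : ℝ) + 1)) :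
    equivConst ρ b = Real.exp ρ / (Real.exp ρ - 1) := by
  have hprod : ∀ n, ∏ i ∈ Finset.range n, b i = 1 / (n.factorial : ℝ) := fun n => by
    induction n with
    | zero => simp
    | succ n ih =>
      rw [Finset.prod_range_succ, ih, hb, Nat.factorial_succ]
      push_cast
      field_simp
  have hexp : HasSum (fun n : ℕ => ρ ^ n / (n.factorial : ℝ)) (Real.exp ρ) := by
    rw [Real.exp_eq_exp_ℝ]
    exact NormedSpace.expSeries_div_hasSum_exp ρ
  have h1 : HasSum (fun n : ℕ => ρ ^ (n + 1) / ((n + 1).factorial : ℝ)) (Real.exp ρ - 1) := by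
    simpa using (hasSum_nat_add_iff' 1).2 hexp
  have h2 : HasSum (fun n : ℕ => ρ ^ (n + 2) / ((n + 2).factorial : ℝ)) (Real.exp ρ - (1 + ρ)) := by
    simpa [Finset.sum_range_succ] using (hasSum_nat_add_iff' 2).2 hexp
  have hN : ∑' n : ℕ, ρ ^ (n + 1) * ∏ i ∈ Finset.range (n + 1), b i = Real.exp ρ - 1 := by
    rw [← h1.tsum_eq]
    exact tsum_congr fun n => by rw [hprod, mul_one_div]
  have hD : ∑' n : ℕ, ρ ^ (n + 1) * ∏ i ∈ Finset.range (n + 2), b i =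
      (Real.exp ρ - (1 + ρ)) / ρ := by
    rw [← (h2.div_const ρ).tsum_eq]
    refine tsum_congr fun n => ?_
    rw [hprod, pow_succ ρ (n + 1)]
    field_simp
  have hpos : Real.exp ρ - 1 ≠ 0 := by
    have := Real.add_one_lt_exp hρ.ne'
    linarith
  rw [equivConst, hN, hD, hb 0]
  have : (1 : ℝ) / ((0 : ℕ) + 1) + (Real.exp ρ - (1 + ρ)) / ρ = (Real.exp ρ - 1) / ρ := by
    field_simp
    push_cast
    ring
  rw [this]
  field_simp
  ring

/-- The tails are proportional: finding the system empty contributes nothing to the numerator of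
`rosTail` and `1` to its normalizing constant, and the other weights agree up to the factor `ρ`. -/
theorem psTail_eq_equivConst_mul_rosTail (hlam : 0 < lam) (hmu : 0 < mu) {b br : ℕ → ℝ}
    (hb : ∀ n, b n ∈ Set.Icc (0 : ℝ) 1) (hbr_zero : br 0 = 1) (hbr_succ : ∀ n, br (n + 1) = b n)
    {π πr : PMF ℕ} (h : IsSteadyState lam mu b π) (hr : IsSteadyState lam mu br πr) (t : ℝ) :
    psTail lam mu b π t = equivConst (lam / mu) b * rosTail lam mu br πr t := by
  have hbr : ∀ n, br n ∈ Set.Icc (0 : ℝ) 1 := fun n => by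
    cases n with
    | zero => simp [hbr_zero]
    | succ n => rw [hbr_succ]; exact hb n
  have := isProbabilityMeasure_sampleLaw hlam hmu
  set ρ := lam / mu with hρ
  have hρ0 : 0 < ρ := div_pos hlam hmu
  have hV : ∀ n, MeasurableSet {ω | ENNReal.ofReal t < psSojourn b n ω} := fun n =>
    measurableSet_lt measurable_const (measurable_psSojourn b n)
  have hW : ∀ n, MeasurableSet {ω | ENNReal.ofReal t < rosWaitFinding br n ω} := fun n => by
    cases n with
    | zero => simp [rosWaitFinding]
    | succ n => exact measurableSet_lt measurable_const (measurable_rosWait br n)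
  have hps := h.cond_joins_real hlam hmu hb hV
  have hros := hr.cond_joins_real hlam hmu hbr hW
  rw [← hρ] at hps hros
  have hs : Summable fun n => ρ ^ (n + 1) * ∏ i ∈ Finset.range (n + 1), b i :=
    (summable_nat_add_iff (f := fun n => ρ ^ n * ∏ i ∈ Finset.range n, b i) 1).2 (h.summable hmu)
  have hs' : Summable fun n => ρ ^ n * ∏ i ∈ Finset.range (n + 1), b i := by
    refine (hs.mul_left ρ⁻¹).congr fun n => ?_
    rw [pow_succ]
    field_simp
  have hprod : ∀ n, ∏ i ∈ Finset.range (n + 1), br i = ∏ i ∈ Finset.range n, b i := fun n => by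
    rw [Finset.prod_range_succ', hbr_zero, mul_one]
    exact Finset.prod_congr rfl fun i _ => hbr_succ i
  have heq : ∀ n, (sampleLaw lam mu).real {ω | ENNReal.ofReal t < rosWaitFinding br (n + 1) ω} =
      (sampleLaw lam mu).real {ω | ENNReal.ofReal t < psSojourn b n ω} := fun n => by
    rw [measureReal_def, measureReal_def]
    congr 1
    exact ((identDistrib_psSojourn_rosWait hlam hmu hb hbr_succ n).measure_mem_eq
      (measurableSet_Ioi (a := ENNReal.ofReal t))).symm
  have hsW : Summable fun n => ρ ^ (n + 1) * (∏ i ∈ Finset.range (n + 1), b i) *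
      (sampleLaw lam mu).real {ω | ENNReal.ofReal t < psSojourn b n ω} := by
    refine Summable.of_nonneg_of_le (fun n => ?_) (fun n => ?_) hs
    · have := Finset.prod_nonneg fun i (_ : i ∈ Finset.range (n + 1)) => (hb i).1
      positivity
    · have := Finset.prod_nonneg fun i (_ : i ∈ Finset.range (n + 1)) => (hb i).1
      exact mul_le_of_le_one_right (by positivity) measureReal_le_one
  have hzero : (sampleLaw lam mu).real {ω | ENNReal.ofReal t < rosWaitFinding br 0 ω} = 0 := by
    simp [rosWaitFinding]
  -- the state `0` drops out, and a shift by one turns the weights of `br` into those of `b`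
  have hnum : ∑' n, ρ ^ n * (∏ i ∈ Finset.range (n + 1), br i) *
        (sampleLaw lam mu).real {ω | ENNReal.ofReal t < rosWaitFinding br n ω} =
      ρ * ∑' n, ρ ^ n * (∏ i ∈ Finset.range (n + 1), b i) *
        (sampleLaw lam mu).real {ω | ENNReal.ofReal t < psSojourn b n ω} := by
    simp_rw [hprod]
    have hsW' : Summable fun n => ρ ^ n * (∏ i ∈ Finset.range n, b i) *
        (sampleLaw lam mu).real {ω | ENNReal.ofReal t < rosWaitFinding br n ω} := by
      refine (summable_nat_add_iff 1).1 (hsW.congr fun n => ?_)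
      rw [heq]
    rw [hsW'.tsum_eq_zero_add, hzero,
      mul_zero, zero_add, ← tsum_mul_left]
    refine tsum_congr fun n => ?_
    rw [heq]
    ring
  have hden : ∑' n, ρ ^ n * ∏ i ∈ Finset.range (n + 1), br i =
      1 + ∑' n, ρ ^ (n + 1) * ∏ i ∈ Finset.range (n + 1), b i := by
    simp_rw [hprod]
    rw [(h.summable hmu).tsum_eq_zero_add]
    simp [hρ]
  have hD : b 0 + ∑' n, ρ ^ (n + 1) * ∏ i ∈ Finset.range (n + 2), b i =
      ∑' n, ρ ^ n * ∏ i ∈ Finset.range (n + 1), b i := by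
    rw [hs'.tsum_eq_zero_add]
    simp
  have hN : 1 + ∑' n, ρ ^ (n + 1) * ∏ i ∈ Finset.range (n + 1), b i ≠ 0 := by
    have : 0 ≤ ∑' n, ρ ^ (n + 1) * ∏ i ∈ Finset.range (n + 1), b i := tsum_nonneg fun n => by
      have := Finset.prod_nonneg fun i (_ : i ∈ Finset.range (n + 1)) => (hb i).1
      positivity
    positivity
  rw [hnum, hden] at hros
  refine hps.trans ?_
  rw [equivConst, hD]
  refine Eq.trans ?_ (congrArg _ hros.symm)
  field_simp

end

theorem mainTheorem6 (lam mu : ℝ) (hlam : 0 < lam) (hmu : 0 < mu)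
    (b br : ℕ → ℝ) (hb : ∀ n, b n ∈ Set.Icc (0 : ℝ) 1)
    (hbr_zero : br 0 = 1) (hbr_succ : ∀ n, br (n + 1) = b n) :
    (∀ n : ℕ, IdentDistrib (psSojourn b n) (rosWait br n)
      (sampleLaw lam mu) (sampleLaw lam mu)) ∧
    (0 < b 0 → ∀ π πr : PMF ℕ, IsSteadyState lam mu b π → IsSteadyState lam mu br πr →
      Summable (fun n : ℕ => (lam / mu) ^ (n + 1) * ∏ i ∈ Finset.range (n + 1), b i) ∧
      Summable (fun n : ℕ => (lam / mu) ^ (n + 1) * ∏ i ∈ Finset.range (n + 2), b i) ∧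
      ∀ t : ℝ, 0 ≤ t →
        psTail lam mu b π t = equivConst (lam / mu) b * rosTail lam mu br πr t) ∧
    ((∀ n : ℕ, b n = 1 / ((n : ℝ) + 1)) →
      equivConst (lam / mu) b = Real.exp (lam / mu) / (Real.exp (lam / mu) - 1)) := by
  refine ⟨identDistrib_psSojourn_rosWait hlam hmu hb hbr_succ, fun _ π πr h hr => ⟨?_, ?_, ?_⟩,
    equivConst_one_div _ (div_pos hlam hmu)⟩
  · exact (summable_nat_add_iff (f := fun n => (lam / mu) ^ n * ∏ i ∈ Finset.range n, b i) 1).2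
      (h.summable hmu)
  · -- up to the factor `lam / mu`, these are the stationary weights from `2` on
    have hs := h.summable hmu
    refine (((summable_nat_add_iff 2).2 hs).mul_left (lam / mu)⁻¹).congr fun n => ?_
    have : lam / mu ≠ 0 := (div_pos hlam hmu).ne'
    rw [pow_succ (lam / mu) (n + 1)]
    field_simp
  · exact fun t _ => psTail_eq_equivConst_mul_rosTail hlam hmu hb hbr_zero hbr_succ h hr t
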